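/- Let $\Omega\subset\mathbb R^d$ ($d\ge 1$) be open, and let $\mathcal T_h$ be a finite mesh of $\Omega$: pairwise disjoint open convex polytopes $K\subset\Omega$ (for instance simplices) with $\overline\Omega=\bigcup_K\overline K$, without hanging nodes (the intersection of two closed elements is a common, possibly empty, face of both). Let $\mathbb C=(C_{ijkl})$ be constant on each $K\in\mathcal T_h$, with $C_{ijkl}=C_{jikl}=C_{ijlk}=C_{klij}$ and, for some $c_*>0$, $\sum_{i,j,k,l} C_{ijkl}\gamma_{kl}\gamma_{ij}\ge c_*\sum_{i,j}\gamma_{ij}^2$ for all symmetric matrices $\gamma$. Put $\varepsilon(v)=\frac12(\nabla v+\nabla v^{T})$, $\sigma(v)=\mathbb C\,\varepsilon(v)$ and $a(u,v)=\int_\Omega\sigma(u):\varepsilon(v)\,dx$ on $H^1_0(\Omega)^d$; write $(\cdot,\cdot)$ and $\|\cdot\|$ for the inner product and norm of $L^2(\Omega)$ (vector- or tensor-valued). For an integer $r\ge0$ let $V_h=\{v\in L^2(\Omega)^d: v|_K\in\mathbb P_r(K)^d\ \forall K\in\mathcal T_h\}$, let $\Pi_h:L^2(\Omega)^d\to V_h$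 be the $L^2$-orthogonal projection, and for a penalty parameter $\alpha>0$ let $$a_h(u,v)=\sum_{K}\int_K\sigma(u):\varepsilon(v)\,dx-\sum_{e}\int_e\{\sigma(u)\nu_e\}\cdot[v]\,dA-\sum_e\int_e\{\sigma(v)\nu_e\}\cdot[u]\,dA+\sum_e\int_e\alpha\,\mathsf h_e^{-1}[u]\cdot[v]\,dA$$ on $V_h\times V_h$. The sums are over elements $K$ and over all faces $e$. On an interior face $e=\partial K^+\cap\partial K^-$, $\{q\}=\frac12(q^++q^-)$, $[q]=q^+-q^-$, the unit normal $\nu_e$ points from $K^+$ to $K^-$, and $\mathsf h_e=\min\{h_{K^+},h_{K^-}\}$; on a boundary face $e\subset\partial K\cap\partial\Omega$, $\{q\}=[q]=q$, $\nu_e$ is the outer unit normal, and $\mathsf h_e=h_K$. Here $h_K=\operatorname{diam}K$. Let $B:V_h\to V_h$ be given by $(Bz,v)=a_h(z,v)$ for all $v\in V_h$. Let $T>0$, $f\in L^2(0,T;L^2(\Omega)^d)$, $u_0\in H^1_0(\Omega)^d$, $u_1\in L^2(\Omega)^d$. * Let $u$ be a weak solution of the elastodynamics problem: $u(t)\in H^1_0(\Omega)^d$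 for $t\in[0,T]$, $u\in L^2(0,T;H^1_0(\Omega)^d)$, $\partial_tu\in L^2(0,T;L^2(\Omega)^d)$, $\partial_{tt}^2u\in L^2(0,T;H^{-1}(\Omega)^d)$, $u(0)=u_0$, $\partial_tu(0)=u_1$, and for a.e. $t\in(0,T)$, $(\partial_{tt}^2u,v)+a(u,v)=(f,v)$ for all $v\in H^1_0(\Omega)^d$ (the first term being the duality pairing, which is the $L^2$ inner product if $\partial^2_{tt}u\in L^2$). * Let $u_h:[0,T]\to V_h$ be the semi-discrete DG approximation: $u_h$ and $\partial_tu_h$ are absolutely continuous, $u_h(0)=\Pi_hu_0$, $\partial_tu_h(0)=\Pi_hu_1$, and for a.e. $t\in(0,T)$, $(\partial_{tt}^2u_h,v)+a_h(u_h,v)=(f,v)$ for all $v\in V_h$. * Let $w$ be the stationary elasticity (SE) reconstruction of $u_h$: $w(t)\in H^1_0(\Omega)^d$ for $t\in[0,T]$ and, for a.e. $t\in(0,T)$, $a(w(t),v)=(Bu_h(t)-\Pi_hf(t)+f(t),\,v)$ for all $v\in H^1_0(\Omega)^d$. Set $\rho=w-u$, $\theta=w-u_h$, $e=u_h-u=\rho-\theta$,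 and suppose that $\theta$ is absolutely continuous on $[0,T]$ with values in $L^2(\Omega)^d$ and derivative $\partial_t\theta\in L^1(0,T;L^2(\Omega)^d)$, i.e. $\theta(t)=\theta(0)+\int_0^t\partial_t\theta\,ds$ on $[0,T]$. Let $C_{F\Omega}\ge0$ be a constant in the Poincaré inequality $\|v\|\le C_{F\Omega}\|\nabla v\|$ for all $v\in H^1_0(\Omega)^d$. Then $$\|\rho\|_{L^\infty(0,T;L^2(\Omega)^d)}\le\sqrt2\,\big(\|u_0-u_h(0)\|+\|\theta(0)\|\big)+2\int_0^T\|\partial_t\theta\|\,dt+2\,C_{F\Omega}\,c_*^{-1/2}\,\|u_1-\partial_tu_h(0)\|,$$ and $$\|e\|_{L^\infty(0,T;L^2(\Omega)^d)}\le\|\theta\|_{L^\infty(0,T;L^2(\Omega)^d)}+\sqrt2\,\big(\|u_0-u_h(0)\|+\|\theta(0)\|\big)+2\int_0^T\|\partial_t\theta\|\,dt+2\,C_{F\Omega}\,c_*^{-1/2}\,\|u_1-\partial_tu_h(0)\|.$$ -/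

import Mathlib

open MeasureTheory Set

open scoped ENNReal ContDiff

noncomputable section

namespace ElastoDG

/-! ### Function spaces -/

/-- The ambient space `ℝ^d` with its Euclidean norm. -/
abbrev Pt (d : ℕ) : Type := EuclideanSpace ℝ (Fin d)

/-- `d × d` tensors with the norm `|σ| = √(σ : σ)`. -/
abbrev Tens (d : ℕ) : Type := EuclideanSpace ℝ (Fin d × Fin d)

/-- The space `L²(Ω)^d`. -/
abbrev L2Vec {d : ℕ} (Ω : Set (Pt d)) : Type := Lp (Pt d) 2 (volume.restrict Ω)

/-- The space `L²(Ω)^{d×d}`. -/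
abbrev L2Tens {d : ℕ} (Ω : Set (Pt d)) : Type := Lp (Tens d) 2 (volume.restrict Ω)

/-- The Hilbert space `L²(Ω)^d × L²(Ω)^{d×d}` with norm `(‖v‖² + ‖G‖²)^{1/2}`; on a pair
`(v, ∇v)` this is the norm of `H¹(Ω)^d`. -/
abbrev H1Pair {d : ℕ} (Ω : Set (Pt d)) : Type := WithLp 2 (L2Vec Ω × L2Tens Ω)

/-- The Jacobian `(∇φ)_{ij} = ∂φ_i / ∂x_j` of a map `φ : ℝ^d → ℝ^d`. -/
def jacobian {d : ℕ} (φ : Pt d → Pt d) (x : Pt d) : Tens d :=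
  WithLp.toLp 2 fun ij => fderiv ℝ φ x (EuclideanSpace.single ij.2 1) ij.1

/-- The pairs `(φ, ∇φ)` with `φ ∈ C_c^∞(Ω)^d`. -/
def testPairs {d : ℕ} (Ω : Set (Pt d)) : Set (H1Pair Ω) :=
  {z | ∃ φ : Pt d → Pt d, ContDiff ℝ ∞ φ ∧ HasCompactSupport φ ∧ tsupport φ ⊆ Ω ∧
    (z.fst : Pt d → Pt d) =ᵐ[volume.restrict Ω] φ ∧
    (z.snd : Pt d → Tens d) =ᵐ[volume.restrict Ω] jacobian φ}

/-- `H¹₀(Ω)^d`, the closure of `C_c^∞(Ω)^d` in the `H¹` norm. An element is stored together with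
its weak gradient: `z.fst` is the function and `z.snd` is its gradient. -/
def H10 {d : ℕ} (Ω : Set (Pt d)) : Submodule ℝ (H1Pair Ω) :=
  (Submodule.span ℝ (testPairs Ω)).topologicalClosure

/-- The underlying `L²(Ω)^d` function of an element of `H¹₀(Ω)^d`. -/
def H10.toFun {d : ℕ} {Ω : Set (Pt d)} (z : H10 Ω) : L2Vec Ω := (z : H1Pair Ω).fst

/-- The weak gradient of an element of `H¹₀(Ω)^d`. -/
def H10.grad {d : ℕ} {Ω : Set (Pt d)} (z : H10 Ω) : L2Tens Ω := (z : H1Pair Ω).snd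

/-- The symmetric gradient `ε(z) = (∇z + ∇zᵀ) / 2`. -/
def H10.strain {d : ℕ} {Ω : Set (Pt d)} (z : H10 Ω) (x : Pt d) (i j : Fin d) : ℝ :=
  (H10.grad z x (i, j) + H10.grad z x (j, i)) / 2

/-- `v` is absolutely continuous on `[0, T]` with derivative `v' ∈ L¹(0, T; X)`; that is, `v` is
the continuous representative of an element of `W^{1,1}(0, T; X)` and `v' = ∂_t v`. -/
def HasTimeDeriv {X : Type*} [NormedAddCommGroup X] [NormedSpace ℝ X] (T : ℝ)
    (v v' : ℝ → X) : Prop :=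
  IntervalIntegrable v' volume 0 T ∧ ∀ t ∈ Icc 0 T, v t = v 0 + ∫ s in (0 : ℝ)..t, v' s

/-! ### Meshes -/

/-- `F` is a facet, i.e. a face of dimension `d - 1`, of the convex set `K ⊆ ℝ^d`. -/
def IsFacet {d : ℕ} (K F : Set (Pt d)) : Prop :=
  F.Nonempty ∧ IsExposed ℝ K F ∧ Module.finrank ℝ (vectorSpan ℝ F) + 1 = d

/-- A finite subdivision of `Ω` into disjoint open convex polytopes `K_i` (the interiors of the
convex hulls of finite vertex sets; simplices in the case of a triangulation) without hanging
nodes: two closed elements meet in a common (possibly empty) face. The numbering of the elements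
serves to orient the interior faces. -/
structure Mesh {d : ℕ} (Ω : Set (Pt d)) where
  N : ℕ
  vertices : Fin N → Finset (Pt d)
  nonempty_interior : ∀ i, (interior (convexHull ℝ (vertices i : Set (Pt d)))).Nonempty
  interior_subset : ∀ i, interior (convexHull ℝ (vertices i : Set (Pt d))) ⊆ Ω
  disjoint_interior : ∀ i j, i ≠ j →
    Disjoint (interior (convexHull ℝ (vertices i : Set (Pt d))))
      (interior (convexHull ℝ (vertices j : Set (Pt d))))
  closure_eq : closure Ω = ⋃ i, convexHull ℝ (vertices i : Set (Pt d))
  conforming : ∀ i j, i ≠ j → IsExposed ℝ (convexHull ℝ (vertices i : Set (Pt d)))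
    (convexHull ℝ (vertices i : Set (Pt d)) ∩ convexHull ℝ (vertices j : Set (Pt d)))

namespace Mesh

variable {d : ℕ} {Ω : Set (Pt d)} (M : Mesh Ω)

/-- The closed element `K̄_i`. -/
def closedElem (i : Fin M.N) : Set (Pt d) := convexHull ℝ (M.vertices i : Set (Pt d))

/-- The open element `K_i`. -/
def elem (i : Fin M.N) : Set (Pt d) := interior (M.closedElem i)

/-- The diameter `h_K` of an element. -/
def diam (i : Fin M.N) : ℝ := Metric.diam (M.elem i)

/-- The intersection `∂K_i ∩ ∂K_j` of two elements. -/
def common (i j : Fin M.N) : Set (Pt d) := M.closedElem i ∩ M.closedElem j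

open Classical in
/-- The interior faces, as pairs `(i, j)` with `i < j` such that `∂K_i ∩ ∂K_j` is a facet that
does not lie on `∂Ω`. Here `K⁺ = K_i` and `K⁻ = K_j`. -/
def interiorFaces : Finset (Fin M.N × Fin M.N) :=
  Finset.univ.filter fun e => e.1 < e.2 ∧ IsFacet (M.closedElem e.1) (M.common e.1 e.2) ∧
    ¬ M.common e.1 e.2 ⊆ frontier Ω

open Classical in
/-- The boundary faces of the element `K_i`: its facets that lie on `∂Ω`. A facet of a polytope is
the convex hull of the vertices that it contains, and it is represented by these vertices. -/
def boundaryFaces (i : Fin M.N) : Finset (Finset (Pt d)) :=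
  (M.vertices i).powerset.filter fun W =>
    IsFacet (M.closedElem i) (convexHull ℝ (W : Set (Pt d))) ∧
    (∀ x ∈ M.vertices i, x ∈ convexHull ℝ (W : Set (Pt d)) → x ∈ W) ∧
    convexHull ℝ (W : Set (Pt d)) ⊆ frontier Ω

end Mesh

/-- `ν` is a unit normal vector on the face `F` of the convex set `K` that points out of `K`. -/
def IsOuterNormal {d : ℕ} (K F : Set (Pt d)) (ν : Pt d) : Prop :=
  ‖ν‖ = 1 ∧ ∀ x ∈ F, ∀ y ∈ K, inner ℝ ν (y - x) ≤ 0

/-- The outer unit normal of `K` on the facet `F`. -/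
def outerNormal {d : ℕ} (K F : Set (Pt d)) : Pt d := Classical.epsilon (IsOuterNormal K F)

/-- A facet has an outer unit normal. -/
theorem exists_isOuterNormal {d : ℕ} {K F : Set (Pt d)} (hK : (interior K).Nonempty)
    (hF : IsFacet K F) : ∃ ν, IsOuterNormal K F ν := by
  obtain ⟨hne, hex, hdim⟩ := hF
  obtain ⟨l, hl⟩ := hex hne
  have hl0 : l ≠ 0 := by
    rintro rfl
    have hFK : F = K := by rw [hl]; ext x; simp
    have h1 : affineSpan ℝ K = ⊤ :=
      top_unique ((isOpen_interior.affineSpan_eq_top hK).symm.le.trans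
        (affineSpan_mono ℝ interior_subset))
    have h2 : vectorSpan ℝ F = ⊤ := by
      rw [hFK, ← direction_affineSpan, h1, AffineSubspace.direction_top]
    rw [h2, finrank_top, finrank_euclideanSpace_fin] at hdim
    omega
  set v := (InnerProductSpace.toDual ℝ (Pt d)).symm l with hv
  have hv0 : v ≠ 0 := by simpa [hv] using hl0
  have hvn : 0 < ‖v‖ := norm_pos_iff.2 hv0
  have hlv : ∀ y, inner ℝ v y = l y := fun y => by simp [hv]
  refine ⟨‖v‖⁻¹ • v, by rw [norm_smul, norm_inv, norm_norm, inv_mul_cancel₀ hvn.ne'], ?_⟩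
  intro x hx y hy
  rw [hl] at hx
  rw [inner_smul_left, hlv, map_sub]
  have := hx.2 y hy
  exact mul_nonpos_of_nonneg_of_nonpos (by simp) (by linarith)

theorem isOuterNormal_outerNormal {d : ℕ} {K F : Set (Pt d)} (hK : (interior K).Nonempty)
    (hF : IsFacet K F) : IsOuterNormal K F (outerNormal K F) :=
  Classical.epsilon_spec (exists_isOuterNormal hK hF)

/-! ### The stiffness tensor and the continuous bilinear form -/

/-- A fourth order tensor `(C_{ijkl})`. -/
abbrev Tensor4 (d : ℕ) : Type := Fin d → Fin d → Fin d → Fin d → ℝ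

/-- `C` has the symmetries `C_{ijkl} = C_{jikl} = C_{ijlk} = C_{klij}` and is positive definite on
symmetric matrices, with constant `c`. -/
def IsStiffness {d : ℕ} (C : Tensor4 d) (c : ℝ) : Prop :=
  (∀ i j k l, C i j k l = C j i k l ∧ C i j k l = C i j l k ∧ C i j k l = C k l i j) ∧
  ∀ γ : Fin d → Fin d → ℝ, (∀ i j, γ i j = γ j i) →
    c * ∑ i, ∑ j, γ i j ^ 2 ≤ ∑ i, ∑ j, ∑ k, ∑ l, C i j k l * γ k l * γ i j

section Forms

variable {d : ℕ} {Ω : Set (Pt d)} (M : Mesh Ω) (C : Fin M.N → Tensor4 d)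

/-- The stiffness tensor at `x`; it equals `C m` on the element `K_m`. -/
def stiffnessAt (x : Pt d) : Tensor4 d :=
  fun i j k l => ∑ m, (M.elem m).indicator (fun _ => C m i j k l) x

/-- `a(u, v) = ∫_Ω σ(u) : ε(v)` with `σ(u) = C ε(u)`. -/
def elasticForm (u v : H10 Ω) : ℝ :=
  ∫ x in Ω, ∑ i, ∑ j, (∑ k, ∑ l, stiffnessAt M C x i j k l * H10.strain u x k l) *
    H10.strain v x i j

/-! ### The discontinuous finite element space -/

/-- A vector field with polynomial components. -/
abbrev PolyField (d : ℕ) : Type := Fin d → MvPolynomial (Fin d) ℝ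

/-- `v` coincides with the polynomial field `p i`, of total degree at most `r`, on each `K_i`. -/
def IsPiecewise (r : ℕ) (v : L2Vec Ω) (p : Fin M.N → PolyField d) : Prop :=
  (∀ i c, (p i c).totalDegree ≤ r) ∧
  ∀ i, ∀ᵐ x ∂volume.restrict (M.elem i), ∀ c, v x c = MvPolynomial.eval x.ofLp (p i c)

variable {M}

theorem ae_elem {P : Pt d → Prop} (i : Fin M.N) (h : ∀ᵐ x ∂volume.restrict Ω, P x) :
    ∀ᵐ x ∂volume.restrict (M.elem i), P x :=
  ae_restrict_of_ae_restrict_of_subset (M.interior_subset i) h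

theorem IsPiecewise.add {r : ℕ} {v w : L2Vec Ω} {p q : Fin M.N → PolyField d}
    (hv : IsPiecewise M r v p) (hw : IsPiecewise M r w q) :
    IsPiecewise M r (v + w) (p + q) := by
  refine ⟨fun i c => (MvPolynomial.totalDegree_add _ _).trans (max_le (hv.1 i c) (hw.1 i c)),
    fun i => ?_⟩
  filter_upwards [hv.2 i, hw.2 i, ae_elem i (Lp.coeFn_add v w)] with x h1 h2 h3 c
  rw [h3]
  simp [h1 c, h2 c]

theorem IsPiecewise.smul {r : ℕ} {v : L2Vec Ω} {p : Fin M.N → PolyField d} (a : ℝ)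
    (hv : IsPiecewise M r v p) : IsPiecewise M r (a • v) (a • p) := by
  refine ⟨fun i c => (MvPolynomial.totalDegree_smul_le _ _).trans (hv.1 i c), fun i => ?_⟩
  filter_upwards [hv.2 i, ae_elem i (Lp.coeFn_smul a v)] with x h1 h2 c
  rw [h2]
  simp [h1 c]

theorem continuous_eval (p : MvPolynomial (Fin d) ℝ) :
    Continuous fun x : Pt d => MvPolynomial.eval x.ofLp p :=
  (MvPolynomial.continuous_eval p).comp (PiLp.continuous_ofLp 2 _)

theorem poly_eq_of_eqOn {U : Set (Pt d)} (hU : IsOpen U) (hne : U.Nonempty)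
    {p q : MvPolynomial (Fin d) ℝ}
    (h : ∀ x ∈ U, MvPolynomial.eval x.ofLp p = MvPolynomial.eval x.ofLp q) : p = q := by
  obtain ⟨x, hx⟩ := hne
  have hV : IsOpen ((fun y : Fin d → ℝ => (WithLp.toLp 2 y : Pt d)) ⁻¹' U) :=
    hU.preimage (PiLp.continuous_toLp 2 _)
  obtain ⟨ε, hε, hb⟩ := Metric.isOpen_iff.1 hV x.ofLp (by simpa using hx)
  refine MvPolynomial.funext_set (fun i => Ioo (x.ofLp i - ε) (x.ofLp i + ε))
    (fun i => Ioo_infinite (by linarith)) fun y hy => ?_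
  refine h (WithLp.toLp 2 y) (hb ?_)
  rw [ball_pi _ hε]
  intro i hi
  simpa only [Real.ball_eq_Ioo] using hy i hi

/-- The polynomial pieces of a function are unique. -/
theorem IsPiecewise.unique {r : ℕ} {v : L2Vec Ω} {p q : Fin M.N → PolyField d}
    (hp : IsPiecewise M r v p) (hq : IsPiecewise M r v q) : p = q := by
  funext i c
  refine poly_eq_of_eqOn (U := M.elem i) isOpen_interior (M.nonempty_interior i) ?_
  refine Measure.eqOn_of_ae_eq (μ := volume) ?_ (continuous_eval _).continuousOn
    (continuous_eval _).continuousOn ?_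
  · filter_upwards [hp.2 i, hq.2 i] with x h1 h2
    rw [← h1 c, ← h2 c]
  · have ho : IsOpen (M.elem i) := isOpen_interior
    rw [ho.interior_eq]
    exact subset_closure

variable (M)

/-- The DG space `V_h = {v ∈ L²(Ω)^d : v|_K ∈ P_r(K)^d for all elements K}`. -/
def Vh (r : ℕ) : Submodule ℝ (L2Vec Ω) where
  carrier := {v | ∃ p, IsPiecewise M r v p}
  add_mem' := fun ⟨_, hp⟩ ⟨_, hq⟩ => ⟨_, hp.add hq⟩
  zero_mem' := by
    refine ⟨0, fun i c => by simp, fun i => ?_⟩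
    filter_upwards [ae_elem i (Lp.coeFn_zero (Pt d) 2 (volume.restrict Ω))] with x hx c
    rw [hx]
    simp
  smul_mem' := fun a _ ⟨_, hp⟩ => ⟨_, hp.smul a⟩

variable {M} {r : ℕ}

/-- The polynomial pieces of `v ∈ V_h`; the trace of `v` on a face of `K_i`, taken from inside
`K_i`, is the restriction of the polynomial `pieces v i`. -/
def pieces (v : Vh M r) : Fin M.N → PolyField d := Classical.choose v.2

theorem isPiecewise_pieces (v : Vh M r) : IsPiecewise M r (v : L2Vec Ω) (pieces v) :=
  Classical.choose_spec v.2

theorem pieces_add (v w : Vh M r) : pieces (v + w) = pieces v + pieces w :=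
  (isPiecewise_pieces (v + w)).unique ((isPiecewise_pieces v).add (isPiecewise_pieces w))

theorem pieces_smul (a : ℝ) (v : Vh M r) : pieces (a • v) = a • pieces v :=
  (isPiecewise_pieces (a • v)).unique ((isPiecewise_pieces v).smul a)

/-- Almost every point of `Ω` lies in an element. -/
theorem ae_mem_elem (M : Mesh Ω) : ∀ᵐ x ∂volume.restrict Ω, ∃ i, x ∈ M.elem i := by
  have h0 : ∀ i : Fin M.N, ∀ᵐ x ∂(volume.restrict Ω : Measure (Pt d)),
      x ∉ frontier (M.closedElem i) := fun i =>
    ae_restrict_of_ae (measure_eq_zero_iff_ae_notMem.1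
      ((convex_convexHull ℝ _).addHaar_frontier volume))
  have hΩ : ∀ᵐ x ∂(volume.restrict Ω : Measure (Pt d)), x ∈ closure Ω :=
    ae_restrict_of_ae_restrict_of_subset subset_closure
      (ae_restrict_mem isClosed_closure.measurableSet)
  filter_upwards [ae_all_iff.2 h0, hΩ] with x hx hc
  rw [M.closure_eq] at hc
  obtain ⟨i, hi⟩ := mem_iUnion.1 hc
  refine ⟨i, by_contra fun hn => hx i ⟨subset_closure hi, hn⟩⟩

instance : FiniteDimensional ℝ (Vh M r) := by
  let f : Vh M r →ₗ[ℝ]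
      (Fin M.N → Fin d → MvPolynomial.restrictTotalDegree (Fin d) ℝ r) :=
    { toFun := fun v i c => ⟨pieces v i c,
        (MvPolynomial.mem_restrictTotalDegree _ _ _).2 ((isPiecewise_pieces v).1 i c)⟩
      map_add' := fun v w => by ext1 i; ext1 c; ext1; simp [pieces_add]
      map_smul' := fun a v => by ext1 i; ext1 c; ext1; simp [pieces_smul] }
  refine Module.Finite.of_injective f fun v w h => Subtype.ext (Lp.ext ?_)
  have hvw : pieces v = pieces w := by
    funext i c
    exact congrArg Subtype.val (congrFun (congrFun h i) c)
  have hv : ∀ᵐ x ∂volume.restrict Ω, ∀ i, x ∈ M.elem i → ∀ c,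
      (v : L2Vec Ω) x c = MvPolynomial.eval x.ofLp (pieces v i c) :=
    ae_all_iff.2 fun i => ae_restrict_of_ae
      ((ae_restrict_iff' isOpen_interior.measurableSet).1 ((isPiecewise_pieces v).2 i))
  have hw : ∀ᵐ x ∂volume.restrict Ω, ∀ i, x ∈ M.elem i → ∀ c,
      (w : L2Vec Ω) x c = MvPolynomial.eval x.ofLp (pieces w i c) :=
    ae_all_iff.2 fun i => ae_restrict_of_ae
      ((ae_restrict_iff' isOpen_interior.measurableSet).1 ((isPiecewise_pieces w).2 i))
  filter_upwards [hv, hw, ae_mem_elem M] with x h1 h2 ⟨i, hi⟩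
  ext c
  rw [h1 i hi c, h2 i hi c, hvw]

instance : CompleteSpace (Vh M r) := FiniteDimensional.complete ℝ _

/-- The `L²` orthogonal projection `Π_h : L²(Ω)^d → V_h`. -/
def projVh (M : Mesh Ω) (r : ℕ) : L2Vec Ω →L[ℝ] Vh M r := (Vh M r).orthogonalProjectionOnto

/-! ### The discontinuous Galerkin form -/

/-- `ε(p)_{ij}` for a polynomial field. -/
def polyStrain (p : PolyField d) (x : Pt d) (i j : Fin d) : ℝ :=
  (MvPolynomial.eval x.ofLp (MvPolynomial.pderiv j (p i)) +
    MvPolynomial.eval x.ofLp (MvPolynomial.pderiv i (p j))) / 2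

/-- `σ(p)_{ij} = ∑_{kl} C_{ijkl} ε(p)_{kl}` for a polynomial field. -/
def polyStress (A : Tensor4 d) (p : PolyField d) (x : Pt d) (i j : Fin d) : ℝ :=
  ∑ k, ∑ l, A i j k l * polyStrain p x k l

/-- The traction `(σ(p) ν)_i`. -/
def traction (A : Tensor4 d) (p : PolyField d) (ν x : Pt d) (i : Fin d) : ℝ :=
  ∑ j, polyStress A p x i j * ν j

/-- The value of a polynomial field. -/
def polyVal (p : PolyField d) (x : Pt d) (i : Fin d) : ℝ := MvPolynomial.eval x.ofLp (p i)

variable (M)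

/-- `∑_K ∫_K σ(p) : ε(q)`. -/
def dgVolume (p q : Fin M.N → PolyField d) : ℝ :=
  ∑ m, ∫ x in M.elem m, ∑ i, ∑ j, polyStress (C m) (p m) x i j * polyStrain (q m) x i j

open scoped MeasureTheory in
/-- `∑_e ∫_e {σ(p) ν_e} · [q]`, with `{σ} = (σ⁺ + σ⁻) / 2` and `[q] = q⁺ - q⁻` on an interior face
whose normal `ν_e` points from `K⁺` to `K⁻`, and `{σ} = σ`, `[q] = q` on a boundary face with outer
normal. The measure `μHE[d - 1]` is the surface measure. -/
def dgConsistency (p q : Fin M.N → PolyField d) : ℝ :=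
  (∑ e ∈ M.interiorFaces, ∫ x in M.common e.1 e.2, ∑ c,
    ((traction (C e.1) (p e.1)
        (outerNormal (M.closedElem e.1) (M.common e.1 e.2)) x c +
      traction (C e.2) (p e.2)
        (outerNormal (M.closedElem e.1) (M.common e.1 e.2)) x c) / 2) *
    (polyVal (q e.1) x c - polyVal (q e.2) x c) ∂μHE[d - 1]) +
  ∑ i, ∑ W ∈ M.boundaryFaces i, ∫ x in convexHull ℝ (W : Set (Pt d)), ∑ c,
    traction (C i) (p i) (outerNormal (M.closedElem i) (convexHull ℝ (W : Set (Pt d)))) x c *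
    polyVal (q i) x c ∂μHE[d - 1]

open scoped MeasureTheory in
/-- `∑_e ∫_e α h_e⁻¹ [p] · [q]`, where `h_e` is the smaller of the diameters of the two elements at
an interior face, and the diameter of the element at a boundary face. -/
def dgPenalty (α : ℝ) (p q : Fin M.N → PolyField d) : ℝ :=
  (∑ e ∈ M.interiorFaces, ∫ x in M.common e.1 e.2, ∑ c,
    α / min (M.diam e.1) (M.diam e.2) *
    (polyVal (p e.1) x c - polyVal (p e.2) x c) *
    (polyVal (q e.1) x c - polyVal (q e.2) x c) ∂μHE[d - 1]) +
  ∑ i, ∑ W ∈ M.boundaryFaces i, ∫ x in convexHull ℝ (W : Set (Pt d)), ∑ c,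
    α / M.diam i * polyVal (p i) x c * polyVal (q i) x c ∂μHE[d - 1]

/-- The symmetric interior penalty form on piecewise polynomials. -/
def dgPoly (α : ℝ) (p q : Fin M.N → PolyField d) : ℝ :=
  dgVolume M C p q - dgConsistency M C p q - dgConsistency M C q p + dgPenalty M α p q

/-- The surface measure of a compact subset of a `k`-dimensional plane is finite. -/
theorem surface_lt_top {F : Set (Pt d)} (hF : IsCompact F) {k : ℕ}
    (hk : Module.finrank ℝ (vectorSpan ℝ F) = k) :
    (Measure.euclideanHausdorffMeasure k : Measure (Pt d)) F < ⊤ := by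
  rcases F.eq_empty_or_nonempty with rfl | ⟨x, hx⟩
  · simp
  set g : vectorSpan ℝ F → Pt d := fun v => (v : Pt d) + x with hg
  have hiso : Isometry g := by
    intro v w
    simp [g, edist_add_right, Subtype.edist_eq]
  have hsub : F = g '' (g ⁻¹' F) := by
    refine (image_preimage_eq_of_subset fun y hy => ?_).symm
    exact ⟨⟨y - x, vsub_mem_vectorSpan ℝ hy hx⟩, by simp [g]⟩
  have hcomp : IsCompact (g ⁻¹' F) := by
    refine hiso.isClosedEmbedding.isCompact_preimage hF
  rw [hsub, hiso.euclideanHausdorffMeasure_image, ← hk,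
    InnerProductSpace.euclideanHausdorffMeasure_eq_volume]
  exact hcomp.measure_lt_top

theorem isCompact_hull (W : Finset (Pt d)) : IsCompact (convexHull ℝ (W : Set (Pt d))) :=
  W.finite_toSet.isCompact_convexHull ℝ

theorem isCompact_common (i j : Fin M.N) : IsCompact (M.common i j) :=
  (isCompact_hull _).inter (isCompact_hull _)

theorem integrableOn_facet {K F : Set (Pt d)} (hK : IsFacet K F) (hF : IsCompact F)
    {f : Pt d → ℝ} (hf : Continuous f) :
    IntegrableOn f F (Measure.euclideanHausdorffMeasure (d - 1)) := by
  have h := surface_lt_top hF (k := d - 1) (by have := hK.2.2; omega)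
  obtain ⟨B, hB⟩ := hF.exists_bound_of_continuousOn hf.continuousOn
  refine IntegrableOn.of_bound h hf.aestronglyMeasurable.restrict B ?_
  exact (ae_restrict_iff' hF.isClosed.measurableSet).2 (Filter.Eventually.of_forall hB)

theorem integrableOn_elem (m : Fin M.N) {f : Pt d → ℝ} (hf : Continuous f) :
    IntegrableOn f (M.elem m) volume :=
  (hf.continuousOn.integrableOn_compact (isCompact_hull (M.vertices m))).mono_set
    interior_subset

theorem continuous_polyVal (p : PolyField d) (i : Fin d) : Continuous fun x => polyVal p x i :=
  continuous_eval _

theorem continuous_polyStrain (p : PolyField d) (i j : Fin d) :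
    Continuous fun x => polyStrain p x i j :=
  ((continuous_eval _).add (continuous_eval _)).div_const 2

theorem continuous_polyStress (A : Tensor4 d) (p : PolyField d) (i j : Fin d) :
    Continuous fun x => polyStress A p x i j :=
  continuous_finsetSum _ fun _ _ => continuous_finsetSum _ fun _ _ =>
    continuous_const.mul (continuous_polyStrain _ _ _)

theorem continuous_traction (A : Tensor4 d) (p : PolyField d) (ν : Pt d) (i : Fin d) :
    Continuous fun x => traction A p ν x i :=
  continuous_finsetSum _ fun _ _ => (continuous_polyStress _ _ _ _).mul continuous_const

theorem polyVal_lin (a : ℝ) (p q : PolyField d) (x : Pt d) (i : Fin d) :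
    polyVal (a • p + q) x i = a * polyVal p x i + polyVal q x i := by
  simp [polyVal]

theorem polyStrain_lin (a : ℝ) (p q : PolyField d) (x : Pt d) (i j : Fin d) :
    polyStrain (a • p + q) x i j = a * polyStrain p x i j + polyStrain q x i j := by
  simp [polyStrain]
  ring

theorem polyStress_lin (A : Tensor4 d) (a : ℝ) (p q : PolyField d) (x : Pt d) (i j : Fin d) :
    polyStress A (a • p + q) x i j = a * polyStress A p x i j + polyStress A q x i j := by
  simp only [polyStress, polyStrain_lin, Finset.mul_sum, ← Finset.sum_add_distrib]
  refine Finset.sum_congr rfl fun _ _ => Finset.sum_congr rfl fun _ _ => by ring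

theorem traction_lin (A : Tensor4 d) (a : ℝ) (p q : PolyField d) (ν x : Pt d) (i : Fin d) :
    traction A (a • p + q) ν x i = a * traction A p ν x i + traction A q ν x i := by
  simp only [traction, polyStress_lin, Finset.mul_sum, ← Finset.sum_add_distrib]
  refine Finset.sum_congr rfl fun _ _ => by ring

theorem integral_lin {μ : Measure (Pt d)} {f g h : Pt d → ℝ} (a : ℝ)
    (hf : Integrable f μ) (hg : Integrable g μ) (hh : ∀ x, h x = a * f x + g x) :
    ∫ x, h x ∂μ = a * ∫ x, f x ∂μ + ∫ x, g x ∂μ := by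
  rw [← integral_const_mul, ← integral_add (hf.const_mul a) hg]
  simp only [hh]

theorem sum_lin {ι : Type*} {s : Finset ι} {f g h : ι → ℝ} (a : ℝ)
    (hh : ∀ i ∈ s, h i = a * f i + g i) :
    ∑ i ∈ s, h i = a * ∑ i ∈ s, f i + ∑ i ∈ s, g i := by
  rw [Finset.sum_congr rfl hh, Finset.sum_add_distrib, Finset.mul_sum]

theorem facet_of_interior {e : Fin M.N × Fin M.N} (he : e ∈ M.interiorFaces) :
    IsFacet (M.closedElem e.1) (M.common e.1 e.2) := by
  simp only [Mesh.interiorFaces, Finset.mem_filter] at he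
  exact he.2.2.1

theorem facet_of_boundary {i : Fin M.N} {W : Finset (Pt d)} (hW : W ∈ M.boundaryFaces i) :
    IsFacet (M.closedElem i) (convexHull ℝ (W : Set (Pt d))) := by
  simp only [Mesh.boundaryFaces, Finset.mem_filter] at hW
  exact hW.2.1

theorem dgVolume_lin (a : ℝ) (p q q' : Fin M.N → PolyField d) :
    dgVolume M C p (a • q + q') = a * dgVolume M C p q + dgVolume M C p q' := by
  have hc : ∀ m (s : PolyField d), Continuous fun x =>
      ∑ i, ∑ j, polyStress (C m) (p m) x i j * polyStrain s x i j := fun m s =>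
    continuous_finsetSum _ fun _ _ => continuous_finsetSum _ fun _ _ =>
      (continuous_polyStress _ _ _ _).mul (continuous_polyStrain _ _ _)
  refine sum_lin a fun m _ => integral_lin a (integrableOn_elem M m (hc m (q m)))
    (integrableOn_elem M m (hc m (q' m))) fun x => ?_
  refine sum_lin a fun i _ => sum_lin a fun j _ => ?_
  rw [Pi.add_apply, Pi.smul_apply, polyStrain_lin]
  ring

theorem continuous_consistency (A B : Tensor4 d) (p p' q q' : PolyField d) (ν : Pt d) :
    Continuous fun x => ∑ c, ((traction A p ν x c + traction B p' ν x c) / 2) *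
      (polyVal q x c - polyVal q' x c) :=
  continuous_finsetSum _ fun _ _ =>
    (((continuous_traction _ _ _ _).add (continuous_traction _ _ _ _)).div_const 2).mul
      ((continuous_polyVal _ _).sub (continuous_polyVal _ _))

theorem continuous_consistency' (A : Tensor4 d) (p q : PolyField d) (ν : Pt d) :
    Continuous fun x => ∑ c, traction A p ν x c * polyVal q x c :=
  continuous_finsetSum _ fun _ _ => (continuous_traction _ _ _ _).mul (continuous_polyVal _ _)

theorem dgConsistency_lin_right (a : ℝ) (p q q' : Fin M.N → PolyField d) :
    dgConsistency M C p (a • q + q') = a * dgConsistency M C p q + dgConsistency M C p q' := by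
  unfold dgConsistency
  rw [mul_add, add_add_add_comm]
  congr 1
  · refine sum_lin a fun e he => integral_lin a
      (integrableOn_facet (facet_of_interior M he) (isCompact_common M _ _)
        (continuous_consistency _ _ _ _ _ _ _))
      (integrableOn_facet (facet_of_interior M he) (isCompact_common M _ _)
        (continuous_consistency _ _ _ _ _ _ _)) fun x => sum_lin a fun c _ => ?_
    simp only [Pi.add_apply, Pi.smul_apply, polyVal_lin]
    ring
  · refine sum_lin a fun i _ => sum_lin a fun W hW => integral_lin a
      (integrableOn_facet (facet_of_boundary M hW) (isCompact_hull _)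
        (continuous_consistency' _ _ _ _))
      (integrableOn_facet (facet_of_boundary M hW) (isCompact_hull _)
        (continuous_consistency' _ _ _ _)) fun x => sum_lin a fun c _ => ?_
    simp only [Pi.add_apply, Pi.smul_apply, polyVal_lin]
    ring

theorem dgConsistency_lin_left (a : ℝ) (p q q' : Fin M.N → PolyField d) :
    dgConsistency M C (a • q + q') p = a * dgConsistency M C q p + dgConsistency M C q' p := by
  unfold dgConsistency
  rw [mul_add, add_add_add_comm]
  congr 1
  · refine sum_lin a fun e he => integral_lin a
      (integrableOn_facet (facet_of_interior M he) (isCompact_common M _ _)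
        (continuous_consistency _ _ _ _ _ _ _))
      (integrableOn_facet (facet_of_interior M he) (isCompact_common M _ _)
        (continuous_consistency _ _ _ _ _ _ _)) fun x => sum_lin a fun c _ => ?_
    simp only [Pi.add_apply, Pi.smul_apply, traction_lin]
    ring
  · refine sum_lin a fun i _ => sum_lin a fun W hW => integral_lin a
      (integrableOn_facet (facet_of_boundary M hW) (isCompact_hull _)
        (continuous_consistency' _ _ _ _))
      (integrableOn_facet (facet_of_boundary M hW) (isCompact_hull _)
        (continuous_consistency' _ _ _ _)) fun x => sum_lin a fun c _ => ?_
    simp only [Pi.add_apply, Pi.smul_apply, traction_lin]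
    ring

theorem dgPenalty_lin (α a : ℝ) (p q q' : Fin M.N → PolyField d) :
    dgPenalty M α p (a • q + q') = a * dgPenalty M α p q + dgPenalty M α p q' := by
  have h1 : ∀ (b : ℝ) (p p' q q' : PolyField d), Continuous fun x => ∑ c,
      b * (polyVal p x c - polyVal p' x c) * (polyVal q x c - polyVal q' x c) :=
    fun b p p' q q' => continuous_finsetSum _ fun _ _ =>
      (continuous_const.mul ((continuous_polyVal _ _).sub (continuous_polyVal _ _))).mul
        ((continuous_polyVal _ _).sub (continuous_polyVal _ _))
  have h2 : ∀ (b : ℝ) (p q : PolyField d), Continuous fun x => ∑ c,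
      b * polyVal p x c * polyVal q x c :=
    fun b p q => continuous_finsetSum _ fun _ _ =>
      (continuous_const.mul (continuous_polyVal _ _)).mul (continuous_polyVal _ _)
  unfold dgPenalty
  rw [mul_add, add_add_add_comm]
  congr 1
  · refine sum_lin a fun e he => integral_lin a
      (integrableOn_facet (facet_of_interior M he) (isCompact_common M _ _) (h1 _ _ _ _ _))
      (integrableOn_facet (facet_of_interior M he) (isCompact_common M _ _) (h1 _ _ _ _ _))
      fun x => sum_lin a fun c _ => ?_
    simp only [Pi.add_apply, Pi.smul_apply, polyVal_lin]
    ring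
  · refine sum_lin a fun i _ => sum_lin a fun W hW => integral_lin a
      (integrableOn_facet (facet_of_boundary M hW) (isCompact_hull _) (h2 _ _ _))
      (integrableOn_facet (facet_of_boundary M hW) (isCompact_hull _) (h2 _ _ _))
      fun x => sum_lin a fun c _ => ?_
    simp only [Pi.add_apply, Pi.smul_apply, polyVal_lin]
    ring

theorem dgPoly_lin (α a : ℝ) (p q q' : Fin M.N → PolyField d) :
    dgPoly M C α p (a • q + q') = a * dgPoly M C α p q + dgPoly M C α p q' := by
  simp only [dgPoly, dgVolume_lin, dgConsistency_lin_right, dgConsistency_lin_left,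
    dgPenalty_lin]
  ring

variable {M}

/-- The discrete bilinear form `a_h` on `V_h × V_h`. -/
def dgForm (α : ℝ) (u v : Vh M r) : ℝ := dgPoly M C α (pieces u) (pieces v)

theorem dgForm_lin (α a : ℝ) (z v w : Vh M r) :
    dgForm C α z (a • v + w) = a * dgForm C α z v + dgForm C α z w := by
  simp only [dgForm, pieces_add, pieces_smul, dgPoly_lin]

/-- The linear functional `a_h(z, ·)` on `V_h`. -/
def dgFunctional (α : ℝ) (z : Vh M r) : Vh M r →ₗ[ℝ] ℝ where
  toFun v := dgForm C α z v
  map_add' v w := by simpa using dgForm_lin C α 1 z v w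
  map_smul' a v := by
    have h0 : dgForm C α z 0 = 0 := by simpa using dgForm_lin C α 1 z 0 0
    simpa [h0] using dgForm_lin C α a z v 0

/-- The discrete operator `B : V_h → V_h`, `(B z, v)_Ω = a_h(z, v)` for all `v ∈ V_h`. -/
def discreteOp (α : ℝ) (z : Vh M r) : Vh M r :=
  (InnerProductSpace.toDual ℝ (Vh M r)).symm (LinearMap.toContinuousLinearMap (dgFunctional C α z))

theorem inner_discreteOp (α : ℝ) (z v : Vh M r) :
    inner ℝ (discreteOp C α z : L2Vec Ω) (v : L2Vec Ω) = dgForm C α z v := by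
  rw [← Submodule.coe_inner, discreteOp, InnerProductSpace.toDual_symm_apply]
  rfl

/-! ### The weak solution, its DG approximation and the stationary reconstruction -/

variable (M)

/-- `u` is a weak solution, with `u' = ∂_t u` and `u'' = ∂²_tt u`:
`u ∈ L²(0, T; H¹₀)`, `u' ∈ L²(0, T; L²)`, `u'' ∈ L²(0, T; H⁻¹)`, `u(0) = u₀`, `u'(0) = u₁` and
`(u''(t), v) + a(u(t), v) = (f(t), v)` for all `v ∈ H¹₀(Ω)^d` and almost every `t ∈ (0, T)`.
Here `(u''(t), v)` is the duality pairing of `H⁻¹` and `H¹₀`, which is the `L²` inner product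
when `u''(t) ∈ L²(Ω)^d`. -/
structure IsWeakSolution (T : ℝ) (f : ℝ → L2Vec Ω) (u₀ : H10 Ω) (u₁ : L2Vec Ω)
    (u : ℝ → H10 Ω) (u' : ℝ → L2Vec Ω) (u'' : ℝ → StrongDual ℝ (H10 Ω)) : Prop where
  memLp_u : MemLp u 2 (volume.restrict (Ioo 0 T))
  memLp_u' : MemLp u' 2 (volume.restrict (Ioo 0 T))
  memLp_u'' : MemLp u'' 2 (volume.restrict (Ioo 0 T))
  deriv_u : HasTimeDeriv T (fun t => H10.toFun (u t)) u'
  deriv_u' : ∀ v : H10 Ω, ∀ t ∈ Icc 0 T,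
    inner ℝ (u' t) (H10.toFun v) = inner ℝ (u' 0) (H10.toFun v) + ∫ s in (0 : ℝ)..t, u'' s v
  initial_u : u 0 = u₀
  initial_u' : u' 0 = u₁
  equation : ∀ᵐ t ∂volume.restrict (Ioo 0 T), ∀ v : H10 Ω,
    u'' t v + elasticForm M C (u t) v = inner ℝ (f t) (H10.toFun v)

/-- `u_h : [0, T] → V_h`, with `u_h' = ∂_t u_h` and `u_h'' = ∂²_tt u_h`, is the semi-discrete DG
approximation: `(u_h'', v) + a_h(u_h, v) = (f, v)` for all `v ∈ V_h` and almost every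
`t ∈ (0, T)`, `u_h(0) = Π_h u₀` and `u_h'(0) = Π_h u₁`. -/
structure IsDGSolution (α T : ℝ) (f : ℝ → L2Vec Ω) (u₀ : H10 Ω) (u₁ : L2Vec Ω)
    (uh uh' uh'' : ℝ → Vh M r) : Prop where
  deriv_uh : HasTimeDeriv T uh uh'
  deriv_uh' : HasTimeDeriv T uh' uh''
  initial_uh : uh 0 = projVh M r (H10.toFun u₀)
  initial_uh' : uh' 0 = projVh M r u₁
  equation : ∀ᵐ t ∂volume.restrict (Ioo 0 T), ∀ v : Vh M r,
    inner ℝ (uh'' t : L2Vec Ω) (v : L2Vec Ω) + dgForm C α (uh t) v =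
      inner ℝ (f t) (v : L2Vec Ω)

variable {M}

/-- `g = B u_h - Π_h f + f`. -/
def reconData (α : ℝ) (f : ℝ → L2Vec Ω) (uh : ℝ → Vh M r) (t : ℝ) : L2Vec Ω :=
  (discreteOp C α (uh t) : L2Vec Ω) - (projVh M r (f t) : L2Vec Ω) + f t

/-- `w(t) ∈ H¹₀(Ω)^d` is the stationary elasticity reconstruction of `u_h(t)`:
`a(w(t), v) = (g(t), v)` for all `v ∈ H¹₀(Ω)^d`. As `f ∈ L²(0, T; L²)` is determined only up to
null sets in time, this is required for almost every `t`. -/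
def IsSEReconstruction (α T : ℝ) (f : ℝ → L2Vec Ω) (uh : ℝ → Vh M r) (w : ℝ → H10 Ω) : Prop :=
  ∀ᵐ t ∂volume.restrict (Ioo 0 T), ∀ v : H10 Ω,
    elasticForm M C (w t) v = inner ℝ (reconData C α f uh t) (H10.toFun v)

end Forms

end ElastoDG

end

open ElastoDG

/-! The reconstruction removes the discrete form from the problem. In `V_h` the scheme reads `u_h''
+ B u_h = Π_h f`, so the data of `w` are `f - u_h''`. Subtracting the weak equation for `u` leaves
`(e'', v) + a(ρ, v) = 0` for all `v ∈ H¹₀`, with `ρ = e + θ`. Of `a_h`, only the definition of `B`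
enters; neither its coercivity nor the size of `α` matters.

Since `e''` lies only in `H⁻¹`, the equation is first integrated in time
(`integrated_error_equation`): `(e'(s), v) = (e'(0), v) - a(∫₀ˢ ρ, v)`. This holds for every `s` and
every `v`, so `v = ρ(s)` is admissible for each `s`. Integrating over `[0, τ]` and putting `P = ∫₀^τ
ρ`, one gets `(‖ρ(τ)‖² - ‖ρ(0)‖²) / 2 = (e'(0), P) - a(P, P) / 2 + ∫₀^τ (ρ, θ')`. The two quadratic
terms come from `∫ B(G, G') = B(G, G) / 2` (`integral_bilin_primitive`), which requires only an
integrable `G'`. With `τ` a maximum point of `‖ρ‖`, Young's inequality absorbs the first term into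
`a(P, P)` and the last into `‖ρ(τ)‖²` (`norm_le_of_integrated_equation`).

The constant `C_F c_*^{-1/2}` rests on Korn's inequality `‖∇v‖² ≤ 2 ‖ε(v)‖²` in `H¹₀`: by density
and integration by parts `∫ ∇v : ∇vᵀ = ∫ (div v)² ≥ 0`, whatever the shape of `Ω`. Then `c_* ‖∇v‖² ≤
2 a(v, v)`, and Poincaré gives `‖v‖ ≤ C_F c_*^{-1/2} √(2 a(v, v))`. Lax–Milgram writes `w(t)` as a
bounded operator applied to `f - u_h''`, which makes `ρ` integrable with values in `H¹₀`. -/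

namespace ElastoDG

/-! ### Absolutely continuous functions of time -/

section Time

variable {X : Type*} [NormedAddCommGroup X] [NormedSpace ℝ X]

/-- `∫₀^τ B(G, G') ds = B(G(τ), G(τ)) / 2` for a primitive `G` with `G(0) = 0` and a symmetric
bounded bilinear form `B`. -/
theorem integral_bilin_primitive [CompleteSpace X] (B : X →L[ℝ] X →L[ℝ] ℝ)
    (hB : ∀ x y, B x y = B y x) {g : ℝ → X} {τ : ℝ} (hτ : 0 ≤ τ)
    (hg : IntervalIntegrable g volume 0 τ) :
    ∫ s in (0 : ℝ)..τ, B (∫ t in (0 : ℝ)..s, g t) (g s) =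
      B (∫ t in (0 : ℝ)..τ, g t) (∫ t in (0 : ℝ)..τ, g t) / 2 := by
  have hgi : Integrable g (volume.restrict (Ioc 0 τ)) :=
    (intervalIntegrable_iff_integrableOn_Ioc_of_le hτ).1 hg
  set μ : Measure ℝ := volume.restrict (Ioc 0 τ) with hμ
  -- Fubini on the square: the full integral of `F` is `B(G(τ), G(τ))`, and by the symmetry of `B`
  -- the two triangles cut off by the diagonal contribute equally.
  set F : ℝ × ℝ → ℝ := fun p => B (g p.1) (g p.2) with hF
  have hFi : Integrable F (μ.prod μ) :=
    hgi.op_fst_snd (op := fun x y => B x y) (by fun_prop) ⟨‖B‖, B.le_opNorm₂⟩ hgi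
  have htot : ∫ p, F p ∂(μ.prod μ) = B (∫ t, g t ∂μ) (∫ t, g t ∂μ) := by
    rw [integral_prod _ hFi]
    simp_rw [hF, ContinuousLinearMap.integral_comp_comm _ hgi]
    change ∫ x, B.flip (∫ y, g y ∂μ) (g x) ∂μ = _
    rw [ContinuousLinearMap.integral_comp_comm _ hgi]
    simp
  set A : Set (ℝ × ℝ) := {p | p.1 ≤ p.2} with hA
  have hAm : MeasurableSet A := measurableSet_le measurable_fst measurable_snd
  have h1 : ∫ p in A, F p ∂(μ.prod μ) = ∫ s, B (∫ t in Ioc 0 s, g t) (g s) ∂μ := by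
    rw [← integral_indicator hAm, integral_prod_symm _ (hFi.indicator hAm), hμ]
    refine setIntegral_congr_fun measurableSet_Ioc fun s hs => ?_
    have : ∀ t, A.indicator F (t, s) = (Iic s).indicator (fun t => B.flip (g s) (g t)) t :=
      fun t => by simp [indicator, hA, hF]
    simp only [this]
    rw [setIntegral_indicator measurableSet_Iic, Ioc_inter_Iic, min_eq_right hs.2,
      ContinuousLinearMap.integral_comp_comm _ (hgi.mono_measure
        (Measure.restrict_mono (Ioc_subset_Ioc_right hs.2) le_rfl))]
    simp
  have h2 : ∫ p in Aᶜ, F p ∂(μ.prod μ) = ∫ s, B (∫ t in Ioc 0 s, g t) (g s) ∂μ := by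
    rw [← integral_indicator hAm.compl, integral_prod _ (hFi.indicator hAm.compl), hμ]
    refine setIntegral_congr_fun measurableSet_Ioc fun s hs => ?_
    have : ∀ t, Aᶜ.indicator F (s, t) = (Iio s).indicator (fun t => B (g s) (g t)) t :=
      fun t => by simp [indicator, hA, hF]
    simp only [this]
    have hset : Ioc 0 τ ∩ Iio s = Ioo 0 s := by
      ext t
      simp only [mem_inter_iff, mem_Ioc, mem_Iio, mem_Ioo]
      exact ⟨fun h => ⟨h.1.1, h.2⟩, fun h => ⟨⟨h.1, h.2.le.trans hs.2⟩, h.2⟩⟩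
    rw [setIntegral_indicator measurableSet_Iio, hset, ← integral_Ioc_eq_integral_Ioo,
      ContinuousLinearMap.integral_comp_comm _ (hgi.mono_measure
        (Measure.restrict_mono (Ioc_subset_Ioc_right hs.2) le_rfl)), hB]
  have h3 : ∫ s in (0 : ℝ)..τ, B (∫ t in (0 : ℝ)..s, g t) (g s) =
      ∫ s, B (∫ t in Ioc 0 s, g t) (g s) ∂μ := by
    rw [intervalIntegral.integral_of_le hτ]
    refine setIntegral_congr_fun measurableSet_Ioc fun s hs => ?_
    simp only [intervalIntegral.integral_of_le hs.1.le]
  have h4 := integral_add_compl hAm hFi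
  rw [h1, h2, htot] at h4
  rw [h3, intervalIntegral.integral_of_le hτ]
  linarith

variable {T : ℝ} {v v' : ℝ → X}

theorem HasTimeDeriv.intervalIntegrable (h : HasTimeDeriv T v v') {t : ℝ} (ht : t ∈ Icc 0 T) :
    IntervalIntegrable v' volume 0 t :=
  h.1.mono_set (by
    rw [uIcc_of_le ht.1, uIcc_of_le (ht.1.trans ht.2)]; exact Icc_subset_Icc_right ht.2)

theorem HasTimeDeriv.continuousOn (h : HasTimeDeriv T v v') : ContinuousOn v (Icc 0 T) := by
  rcases lt_or_ge T 0 with hT | hT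
  · simp [Icc_eq_empty (not_le.2 hT)]
  have hc : ContinuousOn (fun t => v 0 + ∫ s in (0 : ℝ)..t, v' s) (Icc 0 T) := by
    have := intervalIntegral.continuousOn_primitive_interval
      ((intervalIntegrable_iff' (by simp)).1 h.1)
    rw [uIcc_of_le hT] at this
    exact continuousOn_const.add this
  exact hc.congr h.2

theorem HasTimeDeriv.add {w w' : ℝ → X} (hv : HasTimeDeriv T v v') (hw : HasTimeDeriv T w w') :
    HasTimeDeriv T (v + w) (v' + w') := by
  refine ⟨hv.1.add hw.1, fun t ht => ?_⟩
  simp only [Pi.add_apply]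
  rw [intervalIntegral.integral_add (hv.intervalIntegrable ht) (hw.intervalIntegrable ht),
    hv.2 t ht, hw.2 t ht]
  abel

theorem HasTimeDeriv.clm_comp [CompleteSpace X] {Y : Type*} [NormedAddCommGroup Y]
    [NormedSpace ℝ Y] [CompleteSpace Y] (A : X →L[ℝ] Y) (hv : HasTimeDeriv T v v') :
    HasTimeDeriv T (fun t => A (v t)) (fun t => A (v' t)) := by
  refine ⟨⟨A.integrable_comp hv.1.1, A.integrable_comp hv.1.2⟩, fun t ht => ?_⟩
  simp only
  rw [A.intervalIntegral_comp_comm (hv.intervalIntegrable ht), hv.2 t ht, map_add]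

theorem HasTimeDeriv.sub [CompleteSpace X] {w w' : ℝ → X} (hv : HasTimeDeriv T v v')
    (hw : HasTimeDeriv T w w') : HasTimeDeriv T (v - w) (v' - w') := by
  have := hv.add (hw.clm_comp (-ContinuousLinearMap.id ℝ X))
  convert this using 1 <;> · ext t; simp [sub_eq_add_neg]

/-- A continuous `f` is bounded by some `K` on the compact interval, so `‖B‖ K ‖g‖` is an integrable
majorant. -/
theorem _root_.IntervalIntegrable.bilin_continuousOn {Y : Type*} [NormedAddCommGroup Y]
    [NormedSpace ℝ Y] (B : Y →L[ℝ] X →L[ℝ] ℝ) {f : ℝ → Y} {g : ℝ → X} {a b : ℝ}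
    (hg : IntervalIntegrable g volume a b) (hf : ContinuousOn f (uIcc a b)) :
    IntervalIntegrable (fun s => B (f s) (g s)) volume a b := by
  rw [intervalIntegrable_iff' (by simp)] at hg ⊢
  obtain ⟨K, hK⟩ := isCompact_uIcc.exists_bound_of_continuousOn hf
  refine Integrable.mono' (hg.norm.const_mul (‖B‖ * K))
    (B.aestronglyMeasurable_comp₂ (hf.aestronglyMeasurable measurableSet_uIcc) hg.1) ?_
  refine (ae_restrict_iff' measurableSet_uIcc).2 (Filter.Eventually.of_forall fun s hs => ?_)
  refine (B.le_opNorm₂ _ _).trans ?_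
  gcongr
  exact hK s hs

theorem _root_.IntervalIntegrable.inner_continuousOn {L : Type*} [NormedAddCommGroup L]
    [InnerProductSpace ℝ L] {f g : ℝ → L} {a b : ℝ}
    (hg : IntervalIntegrable g volume a b) (hf : ContinuousOn f (uIcc a b)) :
    IntervalIntegrable (fun s => inner ℝ (f s) (g s)) volume a b :=
  hg.bilin_continuousOn (innerSL ℝ) hf

/-- The energy identity for an absolutely continuous function with values in a Hilbert space. -/
theorem HasTimeDeriv.integral_inner {L : Type*} [NormedAddCommGroup L] [InnerProductSpace ℝ L]
    [CompleteSpace L] {v v' : ℝ → L} (h : HasTimeDeriv T v v') {τ : ℝ} (hτ : τ ∈ Icc 0 T) :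
    ∫ s in (0 : ℝ)..τ, inner ℝ (v s) (v' s) = (‖v τ‖ ^ 2 - ‖v 0‖ ^ 2) / 2 := by
  have hi := h.intervalIntegrable hτ
  have hc : ContinuousOn (fun s => ∫ t in (0 : ℝ)..s, v' t) (uIcc 0 τ) :=
    intervalIntegral.continuousOn_primitive_interval ((intervalIntegrable_iff' (by simp)).1 hi)
  have h1 : ∫ s in (0 : ℝ)..τ, inner ℝ (∫ t in (0 : ℝ)..s, v' t) (v' s) =
      inner ℝ (∫ t in (0 : ℝ)..τ, v' t) (∫ t in (0 : ℝ)..τ, v' t) / 2 :=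
    integral_bilin_primitive (innerSL ℝ) (fun x y => real_inner_comm _ _) hτ.1 hi
  have h2 : ∫ s in (0 : ℝ)..τ, inner ℝ (v 0) (v' s) = inner ℝ (v 0) (∫ s in (0 : ℝ)..τ, v' s) :=
    (innerSL ℝ (v 0)).intervalIntegral_comp_comm hi
  -- The initial value is split off because `integral_bilin_primitive` needs a primitive that
  -- vanishes at `0`.
  have h3 : ∫ s in (0 : ℝ)..τ, inner ℝ (v s) (v' s) =
      ∫ s in (0 : ℝ)..τ, (inner ℝ (v 0) (v' s) + inner ℝ (∫ t in (0 : ℝ)..s, v' t) (v' s)) := by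
    refine intervalIntegral.integral_congr fun s hs => ?_
    rw [uIcc_of_le hτ.1] at hs
    simp_rw [h.2 s ⟨hs.1, hs.2.trans hτ.2⟩, inner_add_left]
  have hi2 : IntervalIntegrable (fun s => inner ℝ (∫ t in (0 : ℝ)..s, v' t) (v' s)) volume 0 τ :=
    hi.inner_continuousOn hc
  have hi1 : IntervalIntegrable (fun s => inner ℝ (v 0) (v' s)) volume 0 τ :=
    hi.inner_continuousOn continuousOn_const
  rw [h3, intervalIntegral.integral_add hi1 hi2, h2, h1, h.2 τ hτ, norm_add_sq_real,
    real_inner_self_eq_norm_sq]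
  ring

/-- Stability in `L^∞(L)` of a second order evolution equation in the time-integrated form
`(E'(s), v) = (E'(0), v) - a(∫₀ˢ ρ, v)`, where `ρ' = E' + θ'`. -/
theorem norm_le_of_integrated_equation {V L : Type*} [NormedAddCommGroup V] [NormedSpace ℝ V]
    [CompleteSpace V] [NormedAddCommGroup L] [InnerProductSpace ℝ L] [CompleteSpace L]
    (ι : V →L[ℝ] L) (a : V →L[ℝ] V →L[ℝ] ℝ) (ha : ∀ x y, a x y = a y x)
    (ha0 : ∀ x, 0 ≤ a x x) {κ : ℝ} (hκ : 0 ≤ κ) (hι : ∀ x, ‖ι x‖ ≤ κ * √(2 * a x x))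
    {ρ : ℝ → V} {E' θ' : ℝ → L} (hT : 0 ≤ T) (hρ : IntervalIntegrable ρ volume 0 T)
    (hd : HasTimeDeriv T (fun t => ι (ρ t)) (E' + θ')) (hθ : IntervalIntegrable θ' volume 0 T)
    (heq : ∀ s ∈ Icc 0 T, ∀ x,
      inner ℝ (E' s) (ι x) = inner ℝ (E' 0) (ι x) - a (∫ t in (0 : ℝ)..s, ρ t) x)
    {t : ℝ} (ht : t ∈ Icc 0 T) :
    ‖ι (ρ t)‖ ≤ √2 * ‖ι (ρ 0)‖ + 2 * (∫ t in (0 : ℝ)..T, ‖θ' t‖) + 2 * κ * ‖E' 0‖ := by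
  -- At a maximum point `τ`, every `‖ι (ρ s)‖` under the integral is at most the quantity to be
  -- bounded.
  obtain ⟨τ, hτ, hmax⟩ := isCompact_Icc.exists_isMaxOn ⟨t, ht⟩ hd.continuousOn.norm
  refine (hmax ht).trans ?_
  simp only
  have hsub : uIcc 0 τ ⊆ uIcc 0 T := by
    rw [uIcc_of_le hτ.1, uIcc_of_le hT]; exact Icc_subset_Icc_right hτ.2
  have hc : ContinuousOn (fun t => ι (ρ t)) (uIcc 0 τ) :=
    hd.continuousOn.mono (by rwa [uIcc_of_le hT] at hsub)
  have hρτ := hρ.mono_set hsub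
  have hθτ := hθ.mono_set hsub
  have hEτ : IntervalIntegrable E' volume 0 τ := by
    simpa using (hd.intervalIntegrable hτ).sub hθτ
  set P := ∫ t in (0 : ℝ)..τ, ρ t with hP
  have hPc : ContinuousOn (fun s => ∫ t in (0 : ℝ)..s, ρ t) (uIcc 0 τ) :=
    intervalIntegral.continuousOn_primitive_interval ((intervalIntegrable_iff' (by simp)).1 hρτ)
  have h1 := hd.integral_inner hτ
  simp only [Pi.add_apply, inner_add_right] at h1
  rw [intervalIntegral.integral_add (hEτ.inner_continuousOn hc)
    (hθτ.inner_continuousOn hc)] at h1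
  -- The test element is `ρ s` itself, which depends on `s`; this is legitimate because `heq` holds
  -- at each `s` for all elements of `V`.
  have h2 : ∫ s in (0 : ℝ)..τ, inner ℝ (ι (ρ s)) (E' s) =
      ∫ s in (0 : ℝ)..τ, (inner ℝ (E' 0) (ι (ρ s)) - a (∫ t in (0 : ℝ)..s, ρ t) (ρ s)) := by
    refine intervalIntegral.integral_congr fun s hs => ?_
    rw [uIcc_of_le hτ.1] at hs
    simp_rw [real_inner_comm, heq s ⟨hs.1, hs.2.trans hτ.2⟩]
  have h3 : ∫ s in (0 : ℝ)..τ, inner ℝ (E' 0) (ι (ρ s)) = inner ℝ (E' 0) (ι P) :=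
    ((innerSL ℝ (E' 0)).comp ι).intervalIntegral_comp_comm hρτ
  have hi : IntervalIntegrable (fun s => inner ℝ (E' 0) (ι (ρ s))) volume 0 τ :=
    hρτ.bilin_continuousOn ((innerSL ℝ).bilinearComp (.id ℝ L) ι) continuousOn_const
  rw [intervalIntegral.integral_sub
    hi
    (hρτ.bilin_continuousOn a hPc), h3, integral_bilin_primitive a ha hτ.1 hρτ, ← hP] at h2
  set R := ‖ι (ρ τ)‖ with hR
  set I := ∫ t in (0 : ℝ)..T, ‖θ' t‖ with hI
  have h4 : ∫ s in (0 : ℝ)..τ, inner ℝ (ι (ρ s)) (θ' s) ≤ R * I := by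
    calc _ ≤ ∫ s in (0 : ℝ)..τ, R * ‖θ' s‖ := by
          refine intervalIntegral.integral_mono_on hτ.1
            (hθτ.inner_continuousOn hc) (hθτ.norm.const_mul R) fun s hs => ?_
          refine (real_inner_le_norm _ _).trans ?_
          gcongr
          exact hmax ⟨hs.1, hs.2.trans hτ.2⟩
      _ = R * ∫ s in (0 : ℝ)..τ, ‖θ' s‖ := intervalIntegral.integral_const_mul _ _
      _ ≤ R * I := by
          gcongr
          exact intervalIntegral.integral_mono_interval le_rfl hτ.1 hτ.2
            (Filter.Eventually.of_forall fun _ => norm_nonneg _) hθ.norm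
  have hI0 : 0 ≤ I := intervalIntegral.integral_nonneg hT fun _ _ => norm_nonneg _
  -- Young's inequality, weighted so that `a P P / 2` cancels exactly the term `-a P P / 2` of `h2`.
  have h5 : inner ℝ (E' 0) (ι P) ≤ (κ * ‖E' 0‖) ^ 2 + a P P / 2 := by
    have hs := Real.sq_sqrt (mul_nonneg zero_le_two (ha0 P))
    have h6 : inner ℝ (E' 0) (ι P) ≤ ‖E' 0‖ * (κ * √(2 * a P P)) :=
      (real_inner_le_norm _ _).trans (by gcongr; exact hι P)
    nlinarith [sq_nonneg (κ * ‖E' 0‖ - √(2 * a P P) / 2)]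
  have hD : 0 ≤ κ * ‖E' 0‖ := by positivity
  have h0 : 0 ≤ √2 * ‖ι (ρ 0)‖ := by positivity
  have hsq : (√2 * ‖ι (ρ 0)‖) ^ 2 = 2 * ‖ι (ρ 0)‖ ^ 2 := by
    rw [mul_pow, Real.sq_sqrt zero_le_two]
  -- The collected bounds give `R² ≤ ‖ι (ρ 0)‖² + 2 (κ ‖E' 0‖)² + 2 R I`. With `2 R I ≤ R² / 2 + 2
  -- I²` this becomes `R² ≤ 2 ‖ι (ρ 0)‖² + 4 I² + 4 (κ ‖E' 0‖)²`, which is at most the square of the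
  -- sum of the three roots.
  refine abs_le_of_sq_le_sq' (a := R) ?_ (by positivity) |>.2
  nlinarith [sq_nonneg (R - 2 * I), mul_nonneg h0 hI0, mul_nonneg h0 hD, mul_nonneg hI0 hD]

end Time
/-! ### Korn's inequality -/

section Korn

variable {d : ℕ} {Ω : Set (Pt d)}

/-- Both sides equal minus the integral of `f` against a mixed second derivative of `g`, and these
derivatives commute. The compact support of `f` alone removes the boundary terms. -/
theorem integral_fderiv_mul_fderiv_comm {f g : Pt d → ℝ} (hf : ContDiff ℝ ∞ f)
    (hg : ContDiff ℝ ∞ g) (hfc : HasCompactSupport f) (v w : Pt d) :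
    ∫ x, fderiv ℝ f x v * fderiv ℝ g x w = ∫ x, fderiv ℝ f x w * fderiv ℝ g x v := by
  have hf' : ∀ v, ContDiff ℝ ∞ fun x => fderiv ℝ f x v := fun v =>
    (hf.fderiv_right (m := ∞) (by simp)).clm_apply contDiff_const
  have hg' : ∀ v, ContDiff ℝ ∞ fun x => fderiv ℝ g x v := fun v =>
    (hg.fderiv_right (m := ∞) (by simp)).clm_apply contDiff_const
  have hg'' : ∀ v w, ContDiff ℝ ∞ fun x => fderiv ℝ (fun x => fderiv ℝ g x v) x w := fun v w =>
    ((hg' v).fderiv_right (m := ∞) (by simp)).clm_apply contDiff_const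
  have key : ∀ v w, ∫ x, f x * fderiv ℝ (fun x => fderiv ℝ g x w) x v =
      -∫ x, fderiv ℝ f x v * fderiv ℝ g x w := fun v w =>
    integral_mul_fderiv_eq_neg_fderiv_mul_of_integrable
      (((hf' v).mul (hg' w)).continuous.integrable_of_hasCompactSupport
        ((hfc.fderiv_apply ℝ v).mul_right))
      ((hf.mul (hg'' w v)).continuous.integrable_of_hasCompactSupport hfc.mul_right)
      ((hf.mul (hg' w)).continuous.integrable_of_hasCompactSupport hfc.mul_right)
      (fun x _ => (hf.differentiable (by simp)) x)
      (fun x _ => ((hg' w).differentiable (by simp)) x)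
  have hsymm : ∀ x, fderiv ℝ (fun x => fderiv ℝ g x w) x v =
      fderiv ℝ (fun x => fderiv ℝ g x v) x w := fun x => by
    have hd : DifferentiableAt ℝ (fderiv ℝ g) x :=
      (hg.fderiv_right (m := ∞) (by simp)).differentiable (by simp) x
    have h := (hg.contDiffAt (x := x)).isSymmSndFDerivAt (by
      simpa using (mod_cast le_top : ((2 : ℕ∞) : ℕ∞ω) ≤ (⊤ : ℕ∞)))
    rw [fderiv_clm_apply hd (differentiableAt_const _),
      fderiv_clm_apply hd (differentiableAt_const _)]
    simpa using h v w
  have h1 := key v w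
  simp_rw [hsymm] at h1
  rw [key w v] at h1
  linarith

theorem jacobian_apply {φ : Pt d → Pt d} (hφ : Differentiable ℝ φ) (x : Pt d) (i j : Fin d) :
    jacobian φ x (i, j) = fderiv ℝ (fun y => φ y i) x (EuclideanSpace.single j 1) := by
  have h : HasFDerivAt (fun y => φ y i) ((EuclideanSpace.proj i).comp (fderiv ℝ φ x)) x :=
    (EuclideanSpace.proj (𝕜 := ℝ) i).hasFDerivAt.comp x (hφ x).hasFDerivAt
  rw [h.fderiv]
  rfl

/-- The transposition of tensors. -/
noncomputable def transposeTens (d : ℕ) : Tens d →L[ℝ] Tens d :=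
  (LinearIsometryEquiv.piLpCongrLeft 2 ℝ ℝ (Equiv.prodComm (Fin d) (Fin d))
    : Tens d ≃ₗᵢ[ℝ] Tens d).toContinuousLinearEquiv.toContinuousLinearMap

@[simp]
theorem transposeTens_apply (G : Tens d) (i j : Fin d) :
    transposeTens d G (i, j) = G (j, i) := rfl

theorem inner_transposeTens (G : Tens d) :
    inner ℝ G (transposeTens d G) = ∑ i, ∑ j, G (i, j) * G (j, i) := by
  rw [PiLp.inner_apply, Fintype.sum_prod_type]
  simp [mul_comm]

/-- The pointwise transposition on `L²(Ω)^{d×d}`. -/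
noncomputable def transposeL2 (Ω : Set (Pt d)) : L2Tens Ω →L[ℝ] L2Tens Ω :=
  (transposeTens d).compLpL 2 (volume.restrict Ω)

theorem inner_transposeL2 (G : L2Tens Ω) :
    inner ℝ G (transposeL2 Ω G) = ∫ x in Ω, ∑ i, ∑ j, G x (i, j) * G x (j, i) := by
  rw [L2.inner_def]
  refine integral_congr_ae ?_
  filter_upwards [(transposeTens d).coeFn_compLpL G] with x hx
  rw [transposeL2, hx, inner_transposeTens]

/-- Exchanging the two directions of differentiation in each term turns `∂_j φ_i ∂_i φ_j` into `∂_i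
φ_i ∂_j φ_j` under the integral, and the sum of the latter is `(div φ)²`. -/
theorem integral_jacobian_transpose_nonneg {φ : Pt d → Pt d} (hφ : ContDiff ℝ ∞ φ)
    (hc : HasCompactSupport φ) :
    0 ≤ ∫ x, ∑ i, ∑ j, jacobian φ x (i, j) * jacobian φ x (j, i) := by
  have hdiff : Differentiable ℝ φ := hφ.differentiable (by simp)
  have hs : ∀ i, ContDiff ℝ ∞ fun y => φ y i := fun i => contDiff_euclidean.1 hφ i
  have hsc : ∀ i, HasCompactSupport fun y => φ y i := fun i =>
    hc.comp_left (g := fun z : Pt d => z i) rfl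
  have hi : ∀ (i j : Fin d) (v w : Pt d), Integrable fun x =>
      fderiv ℝ (fun y => φ y i) x v * fderiv ℝ (fun y => φ y j) x w := fun i j v w =>
    ((((hs i).fderiv_right (m := ∞) (by simp)).clm_apply contDiff_const).mul
      (((hs j).fderiv_right (m := ∞) (by simp)).clm_apply
        contDiff_const)).continuous.integrable_of_hasCompactSupport
      (((hsc i).fderiv_apply ℝ v).mul_right)
  simp_rw [jacobian_apply hdiff]
  have h1 : ∫ x, ∑ i, ∑ j, fderiv ℝ (fun y => φ y i) x (EuclideanSpace.single j 1) *
        fderiv ℝ (fun y => φ y j) x (EuclideanSpace.single i 1) =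
      ∫ x, ∑ i, ∑ j, fderiv ℝ (fun y => φ y i) x (EuclideanSpace.single i 1) *
        fderiv ℝ (fun y => φ y j) x (EuclideanSpace.single j 1) := by
    rw [integral_finsetSum _ fun i _ => integrable_finsetSum _ fun j _ => hi i j _ _,
      integral_finsetSum _ fun i _ => integrable_finsetSum _ fun j _ => hi i j _ _]
    refine Finset.sum_congr rfl fun i _ => ?_
    rw [integral_finsetSum _ fun j _ => hi i j _ _, integral_finsetSum _ fun j _ => hi i j _ _]
    exact Finset.sum_congr rfl fun j _ =>
      integral_fderiv_mul_fderiv_comm (hs i) (hs j) (hsc i) _ _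
  rw [h1]
  refine integral_nonneg fun x => ?_
  rw [Pi.zero_apply, ← Finset.sum_mul_sum]
  exact mul_self_nonneg _

/-! ### Test pairs and passage to the limit in `H¹₀` -/

theorem jacobian_add {φ ψ : Pt d → Pt d} (hφ : Differentiable ℝ φ) (hψ : Differentiable ℝ ψ)
    (x : Pt d) : jacobian (φ + ψ) x = jacobian φ x + jacobian ψ x := by
  ext ij
  simp [jacobian, fderiv_add (hφ x) (hψ x)]

theorem jacobian_smul {φ : Pt d → Pt d} (hφ : Differentiable ℝ φ) (a : ℝ)
    (x : Pt d) : jacobian (a • φ) x = a • jacobian φ x := by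
  ext ij
  simp [jacobian, fderiv_const_smul (hφ x)]

/-- Test functions already form a vector space, so in a density argument one may work with a single
`φ` instead of a linear combination. -/
theorem span_testPairs_subset : (Submodule.span ℝ (testPairs Ω) : Set (H1Pair Ω)) ⊆
    testPairs Ω := by
  intro z hz
  induction hz using Submodule.span_induction with
  | mem z h => exact h
  | zero =>
    refine ⟨0, contDiff_const, HasCompactSupport.zero, by simp [tsupport], ?_, ?_⟩
    · exact Lp.coeFn_zero _ _ _
    · refine (Lp.coeFn_zero (Tens d) 2 (volume.restrict Ω)).trans (ae_of_all _ fun x => ?_)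
      ext ij
      simp [jacobian]
  | add z z' _ _ h h' =>
    obtain ⟨φ, h1, h2, h3, h4, h5⟩ := h
    obtain ⟨φ', h1', h2', h3', h4', h5'⟩ := h'
    refine ⟨φ + φ', h1.add h1', h2.add h2',
      (tsupport_add φ φ').trans (union_subset h3 h3'), ?_, ?_⟩
    · exact (Lp.coeFn_add _ _).trans (h4.add h4')
    · refine (Lp.coeFn_add _ _).trans ((h5.add h5').trans (ae_of_all _ fun x => ?_))
      exact (jacobian_add (h1.differentiable (by simp)) (h1'.differentiable (by simp)) x).symm
  | smul a z _ h =>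
    obtain ⟨φ, h1, h2, h3, h4, h5⟩ := h
    refine ⟨a • φ, h1.const_smul a, h2.smul_left (f := fun _ => a),
      (tsupport_smul_subset_right (fun _ => a) φ).trans h3, ?_, ?_⟩
    · exact (Lp.coeFn_smul _ _).trans (h4.const_smul a)
    · refine (Lp.coeFn_smul _ _).trans ((h5.const_smul a).trans (ae_of_all _ fun x => ?_))
      exact (jacobian_smul (h1.differentiable (by simp)) a x).symm

instance : CompleteSpace (H10 Ω) :=
  (Submodule.isClosed_topologicalClosure _).completeSpace_coe

/-- The weak gradient as a bounded operator. -/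
noncomputable def H10.gradL (Ω : Set (Pt d)) : H10 Ω →L[ℝ] L2Tens Ω :=
  (WithLp.sndL 2 ℝ (L2Vec Ω) (L2Tens Ω)).comp (H10 Ω).subtypeL

/-- The embedding `H¹₀(Ω)^d → L²(Ω)^d`. -/
noncomputable def H10.toFunL (Ω : Set (Pt d)) : H10 Ω →L[ℝ] L2Vec Ω :=
  (WithLp.fstL 2 ℝ (L2Vec Ω) (L2Tens Ω)).comp (H10 Ω).subtypeL

/-- `∫_Ω ∇v : ∇vᵀ ≥ 0` on `H¹₀(Ω)^d`, as it equals `∫_Ω (div v)²`. -/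
theorem inner_grad_transpose_nonneg (v : H10 Ω) :
    0 ≤ inner ℝ (H10.grad v) (transposeL2 Ω (H10.grad v)) := by
  -- The condition is closed in the `H¹` norm, so it passes from test pairs to their closure.
  have hcl : IsClosed {z : H1Pair Ω | 0 ≤ inner ℝ z.snd (transposeL2 Ω z.snd)} := by
    have h := (WithLp.sndL 2 ℝ (L2Vec Ω) (L2Tens Ω)).continuous
    exact isClosed_le continuous_const (h.inner ((transposeL2 Ω).continuous.comp h))
  refine closure_minimal (fun z hz => ?_) hcl v.2
  obtain ⟨φ, h1, h2, h3, -, h5⟩ := span_testPairs_subset hz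
  -- Extension by zero moves the integral to the whole space, where integration by parts needs no
  -- regularity of `∂Ω`.
  have hzero : ∀ x, x ∉ Ω → ∑ i, ∑ j, jacobian φ x (i, j) * jacobian φ x (j, i) = 0 := by
    intro x hx
    have : fderiv ℝ φ x = 0 := fderiv_of_notMem_tsupport ℝ fun h => hx (h3 h)
    simp [jacobian, this]
  rw [mem_ofPred_eq, inner_transposeL2]
  have : ∫ x in Ω, ∑ i, ∑ j, z.snd x (i, j) * z.snd x (j, i) =
      ∫ x, ∑ i, ∑ j, jacobian φ x (i, j) * jacobian φ x (j, i) := by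
    rw [← setIntegral_eq_integral_of_forall_compl_eq_zero hzero]
    refine integral_congr_ae ?_
    filter_upwards [h5] with x hx
    rw [hx]
  rw [this]
  exact integral_jacobian_transpose_nonneg h1 h2

/-- Korn's inequality `‖∇v‖² ≤ 2 ‖ε(v)‖²` on `H¹₀(Ω)^d`. -/
theorem korn (v : H10 Ω) :
    ‖H10.grad v‖ ^ 2 ≤ 2 * ∫ x in Ω, ∑ i, ∑ j, H10.strain v x i j ^ 2 := by
  set G := H10.grad v with hG
  -- The factor `1 / 2` here is the source of Korn's constant `2`, once the nonnegative integral of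
  -- `A : Aᵀ` is dropped.
  have hpt : ∀ A : Tens d, ∑ i, ∑ j, ((A (i, j) + A (j, i)) / 2) ^ 2 =
      (inner ℝ A A + inner ℝ A (transposeTens d A)) / 2 := by
    intro A
    have h1 : inner ℝ A A = ∑ i, ∑ j, A (i, j) ^ 2 := by
      rw [PiLp.inner_apply, Fintype.sum_prod_type]
      simp [sq]
    have h2 : ∑ i, ∑ j, A (j, i) ^ 2 = ∑ i, ∑ j, A (i, j) ^ 2 := Finset.sum_comm
    have h3 : ∑ i, ∑ j, ((A (i, j) + A (j, i)) / 2) ^ 2 = (1 / 4) * (∑ i, ∑ j, A (i, j) ^ 2) +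
        ((1 / 4) * (∑ i, ∑ j, A (j, i) ^ 2) + (1 / 2) * ∑ i, ∑ j, A (i, j) * A (j, i)) := by
      simp only [Finset.mul_sum, ← Finset.sum_add_distrib]
      refine Finset.sum_congr rfl fun i _ => Finset.sum_congr rfl fun j _ => by ring
    rw [h3, h2, h1, inner_transposeTens]
    ring
  have h4 : ∫ x in Ω, ∑ i, ∑ j, H10.strain v x i j ^ 2 =
      ∫ x in Ω, (inner ℝ (G x) (G x) + inner ℝ (G x) (transposeL2 Ω G x)) / 2 := by
    refine integral_congr_ae ?_
    filter_upwards [(transposeTens d).coeFn_compLpL G] with x hx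
    rw [transposeL2, hx, ← hpt]
    rfl
  rw [h4, integral_div, integral_add (L2.integrable_inner G G) (L2.integrable_inner _ _),
    ← L2.inner_def, ← L2.inner_def, real_inner_self_eq_norm_sq]
  have := inner_grad_transpose_nonneg v
  linarith

end Korn
/-! ### The elastic form is bounded, symmetric and coercive -/

section Coercivity

variable {d : ℕ} {Ω : Set (Pt d)}

/-- The contraction `∑ A_{ijkl} sym(G)_{kl} sym(H)_{ij}`. -/
noncomputable def tensorForm (A : Tensor4 d) (G H : Tens d) : ℝ :=
  ∑ i, ∑ j, (∑ k, ∑ l, A i j k l * ((G (k, l) + G (l, k)) / 2)) * ((H (i, j) + H (j, i)) / 2)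

theorem tensorForm_lin_left (A : Tensor4 d) (a : ℝ) (G G' H : Tens d) :
    tensorForm A (a • G + G') H = a * tensorForm A G H + tensorForm A G' H := by
  refine sum_lin a fun i _ => sum_lin a fun j _ => ?_
  rw [← mul_assoc, ← add_mul]
  congr 1
  refine sum_lin a fun k _ => sum_lin a fun l _ => ?_
  simp only [PiLp.add_apply, PiLp.smul_apply, smul_eq_mul]
  ring

theorem tensorForm_lin_right (A : Tensor4 d) (a : ℝ) (G H H' : Tens d) :
    tensorForm A G (a • H + H') = a * tensorForm A G H + tensorForm A G H' := by
  refine sum_lin a fun i _ => sum_lin a fun j _ => ?_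
  simp only [PiLp.add_apply, PiLp.smul_apply, smul_eq_mul]
  ring

theorem tensorForm_comm {A : Tensor4 d} (hA : ∀ i j k l, A i j k l = A k l i j) (G H : Tens d) :
    tensorForm A G H = tensorForm A H G := by
  have h : ∀ G H : Tens d, tensorForm A G H = ∑ p : Fin d × Fin d, ∑ q : Fin d × Fin d,
      A p.1 p.2 q.1 q.2 * ((G (q.1, q.2) + G (q.2, q.1)) / 2) *
        ((H (p.1, p.2) + H (p.2, p.1)) / 2) := fun G H => by
    simp only [tensorForm, Fintype.sum_prod_type, Finset.sum_mul]
  rw [h, h, Finset.sum_comm]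
  refine Finset.sum_congr rfl fun p _ => Finset.sum_congr rfl fun q _ => ?_
  rw [hA]
  ring

/-- Each entry of a symmetrized tensor is at most its norm. The bound is crude, but it serves only
integrability and continuity and does not reach the final constants. -/
theorem abs_tensorForm_le (A : Tensor4 d) (G H : Tens d) :
    |tensorForm A G H| ≤ (∑ i, ∑ j, ∑ k, ∑ l, |A i j k l|) * (‖G‖ * ‖H‖) := by
  have hs : ∀ (B : Tens d) i j, |(B (i, j) + B (j, i)) / 2| ≤ ‖B‖ := fun B i j => by
    have h1 := PiLp.norm_apply_le B (i, j)
    have h2 := PiLp.norm_apply_le B (j, i)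
    rw [Real.norm_eq_abs, abs_le] at h1 h2
    rw [abs_le]
    constructor <;> linarith
  simp only [tensorForm, Finset.sum_mul]
  refine (Finset.abs_sum_le_sum_abs _ _).trans (Finset.sum_le_sum fun i _ => ?_)
  refine (Finset.abs_sum_le_sum_abs _ _).trans (Finset.sum_le_sum fun j _ => ?_)
  refine (Finset.abs_sum_le_sum_abs _ _).trans (Finset.sum_le_sum fun k _ => ?_)
  refine (Finset.abs_sum_le_sum_abs _ _).trans (Finset.sum_le_sum fun l _ => ?_)
  rw [abs_mul, abs_mul, mul_assoc]
  gcongr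
  exacts [hs G k l, hs H i j]

/-! ### The elastic form with piecewise constant stiffness -/

variable (M : Mesh Ω) (C : Fin M.N → Tensor4 d)

theorem measurable_stiffnessAt (i j k l : Fin d) :
    Measurable fun x => stiffnessAt M C x i j k l :=
  Finset.measurable_fun_sum _ fun _ _ =>
    measurable_const.indicator isOpen_interior.measurableSet

theorem abs_stiffnessAt_le (x : Pt d) (i j k l : Fin d) :
    |stiffnessAt M C x i j k l| ≤ ∑ m, |C m i j k l| := by
  refine (Finset.abs_sum_le_sum_abs _ _).trans (Finset.sum_le_sum fun m _ => ?_)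
  by_cases h : x ∈ M.elem m <;> simp [h]

theorem stiffnessAt_symm (hC : ∀ m i j k l, C m i j k l = C m k l i j) (x : Pt d)
    (i j k l : Fin d) : stiffnessAt M C x i j k l = stiffnessAt M C x k l i j := by
  simp only [stiffnessAt, hC _ i j k l]

theorem stiffnessAt_of_mem {x : Pt d} {m : Fin M.N} (hx : x ∈ M.elem m) :
    stiffnessAt M C x = C m := by
  funext i j k l
  rw [stiffnessAt, Finset.sum_eq_single m, indicator_of_mem hx]
  · intro n _ hn
    exact indicator_of_notMem (fun h => (M.disjoint_interior n m hn).le_bot ⟨h, hx⟩) _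
  · simp

/-- A bound for the stiffness tensor. -/
noncomputable def stiffnessBound : ℝ := ∑ i, ∑ j, ∑ k, ∑ l, ∑ m, |C m i j k l|

theorem abs_tensorForm_stiffnessAt_le (x : Pt d) (G H : Tens d) :
    |tensorForm (stiffnessAt M C x) G H| ≤ stiffnessBound M C * (‖G‖ * ‖H‖) := by
  refine (abs_tensorForm_le _ _ _).trans ?_
  gcongr
  refine Finset.sum_le_sum fun i _ => Finset.sum_le_sum fun j _ => Finset.sum_le_sum fun k _ =>
    Finset.sum_le_sum fun l _ => abs_stiffnessAt_le M C x i j k l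

theorem aestronglyMeasurable_tensorForm (G H : L2Tens Ω) :
    AEStronglyMeasurable (fun x => tensorForm (stiffnessAt M C x) (G x) (H x))
      (volume.restrict Ω) := by
  have hm : ∀ (B : L2Tens Ω) p, AEStronglyMeasurable (fun x => B x p) (volume.restrict Ω) :=
    fun B p => (EuclideanSpace.proj (𝕜 := ℝ) p).continuous.comp_aestronglyMeasurable
      (Lp.aestronglyMeasurable B)
  have hs : ∀ (B : L2Tens Ω) i j, AEStronglyMeasurable (fun x => (B x (i, j) + B x (j, i)) / 2)
      (volume.restrict Ω) := fun B i j => by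
    simp only [div_eq_mul_inv]
    exact ((hm B (i, j)).add (hm B (j, i))).mul_const _
  refine Finset.aestronglyMeasurable_fun_sum _ fun i _ =>
    Finset.aestronglyMeasurable_fun_sum _ fun j _ => AEStronglyMeasurable.mul ?_ (hs H i j)
  exact Finset.aestronglyMeasurable_fun_sum _ fun k _ =>
    Finset.aestronglyMeasurable_fun_sum _ fun l _ =>
      (measurable_stiffnessAt M C i j k l).aestronglyMeasurable.mul (hs G k l)

theorem integrable_norm_mul_norm (G H : L2Tens Ω) :
    Integrable (fun x => ‖G x‖ * ‖H x‖) (volume.restrict Ω) :=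
  (Lp.memLp G).norm.integrable_mul (Lp.memLp H).norm

theorem integral_norm_mul_norm_le (G H : L2Tens Ω) :
    ∫ x in Ω, ‖G x‖ * ‖H x‖ ≤ ‖G‖ * ‖H‖ := by
  have hn : ∀ B : L2Tens Ω, ‖(Lp.memLp B).norm.toLp‖ = ‖B‖ := fun B => by
    rw [Lp.norm_toLp, eLpNorm_norm, Lp.norm_def]
  rw [← hn G, ← hn H]
  refine le_trans (le_of_eq ?_) (real_inner_le_norm _ _)
  rw [L2.inner_def]
  refine integral_congr_ae ?_
  filter_upwards [(Lp.memLp G).norm.coeFn_toLp, (Lp.memLp H).norm.coeFn_toLp] with x h1 h2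
  rw [h1, h2]
  simp [mul_comm]

theorem integrable_tensorForm (G H : L2Tens Ω) :
    Integrable (fun x => tensorForm (stiffnessAt M C x) (G x) (H x)) (volume.restrict Ω) :=
  ((integrable_norm_mul_norm G H).const_mul (stiffnessBound M C)).mono'
    (aestronglyMeasurable_tensorForm M C G H)
    (ae_of_all _ fun x => abs_tensorForm_stiffnessAt_le M C x _ _)

/-- The form `(G, H) ↦ ∫_Ω C sym(G) : sym(H)` on `L²(Ω)^{d×d}`. -/
noncomputable def tensorFormL2 : L2Tens Ω →L[ℝ] L2Tens Ω →L[ℝ] ℝ :=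
  have hl : ∀ (a : ℝ) (G G' H : L2Tens Ω),
      ∫ x in Ω, tensorForm (stiffnessAt M C x) ((a • G + G') x) (H x) =
        a * (∫ x in Ω, tensorForm (stiffnessAt M C x) (G x) (H x)) +
          ∫ x in Ω, tensorForm (stiffnessAt M C x) (G' x) (H x) := fun a G G' H => by
    rw [← integral_lin a (integrable_tensorForm M C G H) (integrable_tensorForm M C G' H)
      fun x => rfl]
    refine integral_congr_ae ?_
    filter_upwards [Lp.coeFn_add (a • G) G', Lp.coeFn_smul a G] with x h1 h2
    rw [h1, Pi.add_apply, h2, Pi.smul_apply, tensorForm_lin_left]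
  have hr : ∀ (a : ℝ) (G H H' : L2Tens Ω),
      ∫ x in Ω, tensorForm (stiffnessAt M C x) (G x) ((a • H + H') x) =
        a * (∫ x in Ω, tensorForm (stiffnessAt M C x) (G x) (H x)) +
          ∫ x in Ω, tensorForm (stiffnessAt M C x) (G x) (H' x) := fun a G H H' => by
    rw [← integral_lin a (integrable_tensorForm M C G H) (integrable_tensorForm M C G H')
      fun x => rfl]
    refine integral_congr_ae ?_
    filter_upwards [Lp.coeFn_add (a • H) H', Lp.coeFn_smul a H] with x h1 h2
    rw [h1, Pi.add_apply, h2, Pi.smul_apply, tensorForm_lin_right]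
  have hl0 : ∀ H : L2Tens Ω,
      ∫ x in Ω, tensorForm (stiffnessAt M C x) ((0 : L2Tens Ω) x) (H x) = 0 := fun H => by
    simpa using hl 1 0 0 H
  have hr0 : ∀ G : L2Tens Ω,
      ∫ x in Ω, tensorForm (stiffnessAt M C x) (G x) ((0 : L2Tens Ω) x) = 0 := fun G => by
    simpa using hr 1 G 0 0
  LinearMap.mkContinuous₂
    (LinearMap.mk₂ ℝ (fun G H => ∫ x in Ω, tensorForm (stiffnessAt M C x) (G x) (H x))
      (fun G G' H => by simpa using hl 1 G G' H)
      (fun a G H => by simpa only [add_zero, hl0, smul_eq_mul] using hl a G 0 H)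
      (fun G H H' => by simpa using hr 1 G H H')
      (fun a G H => by simpa only [add_zero, hr0, smul_eq_mul] using hr a G H 0))
    (stiffnessBound M C) fun G H => by
      rw [LinearMap.mk₂_apply, mul_assoc]
      refine (norm_integral_le_integral_norm _).trans ?_
      refine (integral_mono (integrable_tensorForm M C G H).norm
        ((integrable_norm_mul_norm G H).const_mul (stiffnessBound M C))
        fun x => abs_tensorForm_stiffnessAt_le M C x _ _).trans ?_
      rw [integral_const_mul]
      exact mul_le_mul_of_nonneg_left (integral_norm_mul_norm_le G H)
        (by unfold stiffnessBound; positivity)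

/-- The elastic form as a bounded bilinear form on `H¹₀(Ω)^d`. -/
noncomputable def elasticFormL : H10 Ω →L[ℝ] H10 Ω →L[ℝ] ℝ :=
  (tensorFormL2 M C).bilinearComp (H10.gradL Ω) (H10.gradL Ω)

/-- Definitional, because `tensorForm` is written with the same symmetrization as `H10.strain`. -/
theorem elasticFormL_apply (u v : H10 Ω) : elasticFormL M C u v = elasticForm M C u v := rfl

theorem elasticForm_comm (hC : ∀ m i j k l, C m i j k l = C m k l i j) (u v : H10 Ω) :
    elasticForm M C u v = elasticForm M C v u :=
  integral_congr_ae (ae_of_all _ fun x =>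
    tensorForm_comm (stiffnessAt_symm M C hC x) (H10.grad u x) (H10.grad v x))

/-! ### Coercivity and its constants -/

variable {M C}

theorem elasticForm_coercive {c : ℝ} (hc : 0 ≤ c) (hC : ∀ m, IsStiffness (C m) c) (v : H10 Ω) :
    c * ‖H10.grad v‖ ^ 2 ≤ 2 * elasticForm M C v v := by
  have h1 : c * ∫ x in Ω, ∑ i, ∑ j, H10.strain v x i j ^ 2 ≤ elasticForm M C v v := by
    rw [← integral_const_mul]
    have hi := integrable_tensorForm M C (H10.grad v) (H10.grad v)
    refine integral_mono_of_nonneg (ae_of_all _ fun x => by positivity) hi ?_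
    -- Outside the open elements `stiffnessAt` is zero, so the lower bound can be had only almost
    -- everywhere.
    filter_upwards [ae_mem_elem M] with x ⟨m, hm⟩
    have := (hC m).2 (H10.strain v x) fun i j => by simp only [H10.strain, add_comm]
    refine this.trans (le_of_eq ?_)
    simp only [stiffnessAt_of_mem M C hm, Finset.sum_mul]
  have := mul_le_mul_of_nonneg_left (korn v) hc
  linarith

theorem elasticForm_self_nonneg {c : ℝ} (hc : 0 ≤ c) (hC : ∀ m, IsStiffness (C m) c)
    (v : H10 Ω) : 0 ≤ elasticForm M C v v := by
  have := elasticForm_coercive hc hC v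
  have : 0 ≤ c * ‖H10.grad v‖ ^ 2 := by positivity
  linarith

/-- Poincaré followed by coercivity. Korn's factor `2` is kept under the root, which is the form
that `norm_le_of_integrated_equation` expects. -/
theorem norm_toFun_le_elasticForm {c : ℝ} (hc : 0 < c) (hC : ∀ m, IsStiffness (C m) c)
    {CF : ℝ} (hCF0 : 0 ≤ CF) (hCF : ∀ v : H10 Ω, ‖H10.toFun v‖ ≤ CF * ‖H10.grad v‖)
    (v : H10 Ω) : ‖H10.toFun v‖ ≤ CF * (√c)⁻¹ * √(2 * elasticForm M C v v) := by
  refine (hCF v).trans ?_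
  rw [mul_assoc]
  gcongr
  rw [inv_mul_eq_div, le_div_iff₀ (Real.sqrt_pos.2 hc)]
  refine Real.le_sqrt_of_sq_le ?_
  rw [mul_pow, Real.sq_sqrt hc.le, mul_comm]
  exact elasticForm_coercive hc.le hC v

theorem isCoercive_elasticFormL {c : ℝ} (hc : 0 < c) (hC : ∀ m, IsStiffness (C m) c)
    {CF : ℝ} (hCF : ∀ v : H10 Ω, ‖H10.toFun v‖ ≤ CF * ‖H10.grad v‖) :
    IsCoercive (elasticFormL M C) := by
  have hK : 0 < CF ^ 2 + 1 := by positivity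
  -- The `2` is Korn's constant, and `CF ^ 2 + 1` compares the full `H¹` norm with the gradient
  -- norm.
  refine ⟨c / (2 * (CF ^ 2 + 1)), by positivity, fun v => ?_⟩
  rw [elasticFormL_apply]
  have h1 : ‖v‖ * ‖v‖ ≤ (CF ^ 2 + 1) * ‖H10.grad v‖ ^ 2 := by
    have h2 : ‖v‖ ^ 2 = ‖H10.toFun v‖ ^ 2 + ‖H10.grad v‖ ^ 2 :=
      WithLp.prod_norm_sq_eq_of_L2 (v : H1Pair Ω)
    have h3 : ‖H10.toFun v‖ ^ 2 ≤ (CF * ‖H10.grad v‖) ^ 2 := by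
      gcongr
      exact hCF v
    nlinarith
  have h4 := elasticForm_coercive hc.le hC v
  calc c / (2 * (CF ^ 2 + 1)) * ‖v‖ * ‖v‖
      = c / (2 * (CF ^ 2 + 1)) * (‖v‖ * ‖v‖) := by ring
    _ ≤ c / (2 * (CF ^ 2 + 1)) * ((CF ^ 2 + 1) * ‖H10.grad v‖ ^ 2) := by gcongr
    _ = c * ‖H10.grad v‖ ^ 2 / 2 := by field_simp
    _ ≤ _ := by linarith

end Coercivity
/-! ### The error equation -/

section Error

variable {d : ℕ} {Ω : Set (Pt d)} {M : Mesh Ω} {C : Fin M.N → Tensor4 d} {r : ℕ} {α T : ℝ}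
  {f : ℝ → L2Vec Ω}

theorem _root_.MeasureTheory.MemLp.intervalIntegrable_of_Ioo {X : Type*} [NormedAddCommGroup X]
    {g : ℝ → X} {p : ℝ≥0∞} (hg : MemLp g p (volume.restrict (Ioo 0 T))) (hp : 1 ≤ p)
    (hT : 0 ≤ T) : IntervalIntegrable g volume 0 T :=
  (intervalIntegrable_iff_integrableOn_Ioo_of_le hT).2 (hg.integrable hp)

theorem _root_.MeasureTheory.MemLp.dual_apply {S V : Type*} [MeasurableSpace S] {μ : Measure S}
    [NormedAddCommGroup V] [NormedSpace ℝ V] {g : S → StrongDual ℝ V} {p : ℝ≥0∞}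
    (hg : MemLp g p μ) (v : V) : MemLp (fun s => g s v) p μ :=
  (ContinuousLinearMap.apply ℝ ℝ v).comp_memLp' hg

/-- The equation of the DG approximation in `V_h`: `u_h'' + B u_h = Π_h f`. -/
theorem IsDGSolution.ae_eq {u₀ : H10 Ω} {u₁ : L2Vec Ω} {uh uh' uh'' : ℝ → Vh M r}
    (h : IsDGSolution M C α T f u₀ u₁ uh uh' uh'') :
    ∀ᵐ t ∂volume.restrict (Ioo 0 T), uh'' t + discreteOp C α (uh t) = projVh M r (f t) := by
  filter_upwards [h.equation] with t ht
  refine ext_inner_right ℝ fun v => ?_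
  have h1 := ht v
  rw [← inner_discreteOp] at h1
  rw [inner_add_left, projVh, Submodule.inner_orthogonalProjectionOnto_eq_of_mem_right]
  simpa using h1

/-- `B u_h - Π_h f + f = f - u_h''`. -/
theorem IsDGSolution.reconData_ae_eq {u₀ : H10 Ω} {u₁ : L2Vec Ω} {uh uh' uh'' : ℝ → Vh M r}
    (h : IsDGSolution M C α T f u₀ u₁ uh uh' uh'') :
    ∀ᵐ t ∂volume.restrict (Ioo 0 T), reconData C α f uh t = f t - (uh'' t : L2Vec Ω) := by
  filter_upwards [h.ae_eq] with t ht
  rw [reconData, ← ht, Submodule.coe_add]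
  abel

/-- The stationary reconstruction is integrable in time with values in `H¹₀(Ω)^d`. -/
theorem IsSEReconstruction.intervalIntegrable {uh : ℝ → Vh M r} {w : ℝ → H10 Ω}
    (hw : IsSEReconstruction C α T f uh w) (hco : IsCoercive (elasticFormL M C)) (hT : 0 ≤ T)
    {g : ℝ → L2Vec Ω} (hg : IntervalIntegrable g volume 0 T)
    (hgr : ∀ᵐ t ∂volume.restrict (Ioo 0 T), reconData C α f uh t = g t) :
    IntervalIntegrable w volume 0 T := by
  rw [intervalIntegrable_iff_integrableOn_Ioo_of_le hT] at hg ⊢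
  -- Lax–Milgram: `w = A⁻¹ ι* g` almost everywhere, where `A` represents `a` in the `H¹` inner
  -- product and `ι` embeds `H¹₀` in `L²`. This bounded operator carries integrability from `g` to
  -- `w`.
  refine ((hco.continuousLinearEquivOfBilin.symm.toContinuousLinearMap.comp
    (ContinuousLinearMap.adjoint (H10.toFunL Ω))).integrable_comp hg).congr ?_
  filter_upwards [hw, hgr] with t h1 h2
  change hco.continuousLinearEquivOfBilin.symm (ContinuousLinearMap.adjoint (H10.toFunL Ω) (g t)) =
    w t
  rw [ContinuousLinearEquiv.symm_apply_eq]
  refine ext_inner_right ℝ fun v => ?_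
  rw [ContinuousLinearMap.adjoint_inner_left, IsCoercive.continuousLinearEquivOfBilin_apply,
    elasticFormL_apply, h1 v, h2]
  rfl

/-- The time-integrated error equation
`(e'(s), v) = (e'(0), v) - a(∫₀ˢ ρ, v)` with `e = u_h - u` and `ρ = w - u`. -/
theorem integrated_error_equation {u₀ : H10 Ω} {u₁ : L2Vec Ω}
    {u : ℝ → H10 Ω} {u' : ℝ → L2Vec Ω} {u'' : ℝ → StrongDual ℝ (H10 Ω)}
    (hu : IsWeakSolution M C T f u₀ u₁ u u' u'')
    {uh uh' uh'' : ℝ → Vh M r} (huh : IsDGSolution M C α T f u₀ u₁ uh uh' uh'')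
    {w : ℝ → H10 Ω} (hw : IsSEReconstruction C α T f uh w)
    (hρ : IntervalIntegrable (fun t => w t - u t) volume 0 T) (hT : 0 ≤ T)
    {s : ℝ} (hs : s ∈ Icc 0 T) (v : H10 Ω) :
    inner ℝ ((uh' s : L2Vec Ω) - u' s) (H10.toFun v) =
      inner ℝ ((uh' 0 : L2Vec Ω) - u' 0) (H10.toFun v) -
        elasticFormL M C (∫ t in (0 : ℝ)..s, (w t - u t)) v := by
  have hsub : uIcc 0 s ⊆ uIcc 0 T := by
    rw [uIcc_of_le hs.1, uIcc_of_le hT]; exact Icc_subset_Icc_right hs.2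
  have h1 : HasTimeDeriv T (fun t => inner ℝ (H10.toFun v) (uh' t : L2Vec Ω))
      (fun t => inner ℝ (H10.toFun v) (uh'' t : L2Vec Ω)) :=
    huh.deriv_uh'.clm_comp ((innerSL ℝ (H10.toFun v)).comp (Vh M r).subtypeL)
  have hi1 := h1.intervalIntegrable hs
  have hi2 : IntervalIntegrable (fun t => u'' t v) volume 0 s := by
    exact IntervalIntegrable.mono_set
      ((hu.memLp_u''.dual_apply v).intervalIntegrable_of_Ioo one_le_two hT) hsub
  have h2 : (∫ t in (0 : ℝ)..s, inner ℝ (H10.toFun v) (uh'' t : L2Vec Ω)) -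
      ∫ t in (0 : ℝ)..s, u'' t v = -elasticFormL M C (∫ t in (0 : ℝ)..s, (w t - u t)) v := by
    rw [← intervalIntegral.integral_sub hi1 hi2]
    -- With `v` fixed the form is a bounded functional of its first argument, so it commutes with
    -- the `H¹₀`-valued integral.
    change _ = -(elasticFormL M C).flip v (∫ t in (0 : ℝ)..s, (w t - u t))
    rw [← ((elasticFormL M C).flip v).intervalIntegral_comp_comm (hρ.mono_set hsub),
      ← intervalIntegral.integral_neg, intervalIntegral.integral_of_le hs.1,
      intervalIntegral.integral_of_le hs.1, integral_Ioc_eq_integral_Ioo,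
      integral_Ioc_eq_integral_Ioo]
    refine integral_congr_ae ?_
    refine ae_restrict_of_ae_restrict_of_subset (Ioo_subset_Ioo_right hs.2) ?_
    -- At almost every time `f` cancels between the equation for `u` and that for `w`, leaving
    -- `(u_h'', v) - u''(v) = -a(w - u, v)`.
    filter_upwards [hu.equation, hw, huh.reconData_ae_eq] with t e1 e2 e3
    have e1 := e1 v
    have e2 := e2 v
    rw [e3, inner_sub_left] at e2
    rw [ContinuousLinearMap.flip_apply, map_sub, sub_apply, elasticFormL_apply, elasticFormL_apply,
      real_inner_comm]
    linarith
  have h3 := h1.2 s hs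
  simp only at h3
  rw [inner_sub_left, inner_sub_left, hu.deriv_u' v s hs, real_inner_comm, h3, real_inner_comm]
  linarith

end Error

end ElastoDG
-- The error bounds
theorem mainTheorem4 {d : ℕ} (hd : 1 ≤ d) (Ω : Set (Pt d)) (hΩ : IsOpen Ω) (M : Mesh Ω)
    (C : Fin M.N → Tensor4 d) (cstar : ℝ) (hcstar : 0 < cstar)
    (hC : ∀ m, IsStiffness (C m) cstar)
    (r : ℕ) (α : ℝ) (hα : 0 < α) (T : ℝ) (hT : 0 < T)
    (f : ℝ → L2Vec Ω) (hf : MemLp f 2 (volume.restrict (Ioo 0 T)))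
    (u₀ : H10 Ω) (u₁ : L2Vec Ω)
    (u : ℝ → H10 Ω) (u' : ℝ → L2Vec Ω) (u'' : ℝ → StrongDual ℝ (H10 Ω))
    (hu : IsWeakSolution M C T f u₀ u₁ u u' u'')
    (uh uh' uh'' : ℝ → Vh M r) (huh : IsDGSolution M C α T f u₀ u₁ uh uh' uh'')
    (w : ℝ → H10 Ω) (hw : IsSEReconstruction C α T f uh w)
    (ρ θ e θ' : ℝ → L2Vec Ω)
    (hρ : ∀ t, ρ t = H10.toFun (w t) - H10.toFun (u t))
    (hθ : ∀ t, θ t = H10.toFun (w t) - (uh t : L2Vec Ω))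
    (he : ∀ t, e t = (uh t : L2Vec Ω) - H10.toFun (u t))
    (hθ' : HasTimeDeriv T θ θ')
    (CF : ℝ) (hCF0 : 0 ≤ CF) (hCF : ∀ v : H10 Ω, ‖H10.toFun v‖ ≤ CF * ‖H10.grad v‖) :
    eLpNorm ρ ⊤ (volume.restrict (Ioo 0 T)) ≤
      ENNReal.ofReal (√2 * (‖H10.toFun u₀ - (uh 0 : L2Vec Ω)‖ + ‖θ 0‖) +
        2 * (∫ t in (0 : ℝ)..T, ‖θ' t‖) + 2 * CF * (√cstar)⁻¹ * ‖u₁ - (uh' 0 : L2Vec Ω)‖) ∧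
    eLpNorm e ⊤ (volume.restrict (Ioo 0 T)) ≤
      eLpNorm θ ⊤ (volume.restrict (Ioo 0 T)) +
      ENNReal.ofReal (√2 * (‖H10.toFun u₀ - (uh 0 : L2Vec Ω)‖ + ‖θ 0‖) +
        2 * (∫ t in (0 : ℝ)..T, ‖θ' t‖) + 2 * CF * (√cstar)⁻¹ * ‖u₁ - (uh' 0 : L2Vec Ω)‖) := by
  have hT0 : 0 ≤ T := hT.le
  have hsymm : ∀ m i j k l, C m i j k l = C m k l i j := fun m i j k l => ((hC m).1 i j k l).2.2
  have hco := isCoercive_elasticFormL hcstar hC hCF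
  have hwi : IntervalIntegrable w volume 0 T := by
    refine hw.intervalIntegrable hco hT0 (g := fun t => f t - (uh'' t : L2Vec Ω)) ?_
      huh.reconData_ae_eq
    exact (hf.intervalIntegrable_of_Ioo one_le_two hT0).sub
      (huh.deriv_uh'.clm_comp (Vh M r).subtypeL).1
  have hρi : IntervalIntegrable (fun t => w t - u t) volume 0 T :=
    hwi.sub (hu.memLp_u.intervalIntegrable_of_Ioo one_le_two hT0)
  have hρL : ∀ t, H10.toFunL Ω (w t - u t) = ρ t := fun t => by
    rw [hρ, map_sub]
    rfl
  have hρe : ρ = e + θ := by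
    funext t
    rw [Pi.add_apply, hρ, he, hθ]
    abel
  -- The time derivative of `ρ` is obtained through `ρ = e + θ`, without differentiating `w`
  -- separately.
  have hd : HasTimeDeriv T ρ ((fun t => (uh' t : L2Vec Ω) - u' t) + θ') := by
    have h : HasTimeDeriv T e (fun t => (uh' t : L2Vec Ω) - u' t) := by
      rw [funext he]
      exact (huh.deriv_uh.clm_comp (Vh M r).subtypeL).sub hu.deriv_u
    rw [hρe]
    exact h.add hθ'
  set K := √2 * (‖H10.toFun u₀ - (uh 0 : L2Vec Ω)‖ + ‖θ 0‖) +
    2 * (∫ t in (0 : ℝ)..T, ‖θ' t‖) + 2 * CF * (√cstar)⁻¹ * ‖u₁ - (uh' 0 : L2Vec Ω)‖ with hK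
  have hbound : ∀ t ∈ Icc 0 T, ‖ρ t‖ ≤ K := fun t ht => by
    have h := norm_le_of_integrated_equation (H10.toFunL Ω) (elasticFormL M C)
      (elasticForm_comm M C hsymm) (elasticForm_self_nonneg hcstar.le hC)
      (κ := CF * (√cstar)⁻¹) (by positivity) (norm_toFun_le_elasticForm hcstar hC hCF0 hCF)
      hT0 hρi (by simpa only [hρL] using hd) hθ'.1
      (fun s hs v => integrated_error_equation hu huh hw hρi hT0 hs v) ht
    rw [hρL, hρL, norm_sub_rev, hu.initial_u', ← mul_assoc] at h
    refine h.trans ?_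
    rw [hK]
    gcongr
    -- Stability produces `‖ρ 0‖`; splitting `ρ 0 = e 0 + θ 0` gives the two initial terms of `K`.
    rw [hρe, Pi.add_apply, he, hu.initial_u, norm_sub_rev (H10.toFun u₀)]
    exact norm_add_le _ _
  have hmain : eLpNorm ρ ⊤ (volume.restrict (Ioo 0 T)) ≤ ENNReal.ofReal K := by
    rw [eLpNorm_exponent_top]
    refine eLpNormEssSup_le_of_ae_bound ?_
    filter_upwards [ae_restrict_mem measurableSet_Ioo] with t ht
    exact hbound t (Ioo_subset_Icc_self ht)
  refine ⟨hmain, ?_⟩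
  -- The triangle inequality for `eLpNorm` asks for measurability, which here follows from
  -- continuity in time.
  have hm : ∀ {v v' : ℝ → L2Vec Ω}, HasTimeDeriv T v v' →
      AEStronglyMeasurable v (volume.restrict (Ioo 0 T)) := fun h =>
    ((h.continuousOn).mono Ioo_subset_Icc_self).aestronglyMeasurable measurableSet_Ioo
  have heq : e = ρ - θ := by rw [hρe, add_sub_cancel_right]
  rw [heq, add_comm]
  refine (eLpNorm_sub_le (hm hd) (hm hθ') le_top).trans ?_
  gcongr
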